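/- A bisimplicial set $X$ is regarded as a simplicial space $n\mapsto X_n$. Write $F(n)$ for the discrete simplicial space represented by $[n]$, and regard $\Delta[m]$ as a constant simplicial space. For bisimplicial sets $A,X$ let $\mathrm{Map}(A,X)$ be the simplicial set with $\mathrm{Map}(A,X)_m=\mathrm{Hom}(A\times\Delta[m],X)$, and let $X^A$ be the internal hom, $(X^A)_n=\mathrm{Map}(A\times F(n),X)$. A Segal space is a Reedy fibrant bisimplicial set $X$ such that for all $n$ the Segal map $X_n\to X_1\times_{X_0}\cdots\times_{X_0}X_1$ is a weak equivalence of simplicial sets. For a bisimplicial set $B$, a Segal space over $B$ is a Segal space $X$ together with a Reedy fibration $\delta\colon X\to B$. For maps $\pi\colon A\to B$ and $\delta\colon X\to B$ put $$\mathrm{Map}_{/B}(A,X)=\mathrm{Map}(A,X)\times_{\mathrm{Map}(A,B)}\Delta[0],\qquad \mathrm{Fun}_{/B}(A,X)=X^A\times_{B^A}F(0),$$ the fibers over $\pi$ of the maps induced by $\delta$. **Lemma.** Let $B$ be a Segal space, let $\pi\colon A\to B$ and $\xi\colon S\to B$ be maps of bisimplicial sets, and let $\iota\colon A\to S$ be a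 map over $B$ that exhibits $S$ as a Segal space completion of $A$ relative to $B$; that is, $S$ is a Segal space, and for every Segal space $Y$ over $B$ the map $\iota^*\colon\mathrm{Map}_{/B}(S,Y)\to\mathrm{Map}_{/B}(A,Y)$ is a weak equivalence of simplicial sets. Then for every Segal space $X$ over $B$ the induced map $$\iota^*\colon\mathrm{Fun}_{/B}(S,X)\to\mathrm{Fun}_{/B}(A,X)$$ is an equivalence of Segal spaces: both sides are Segal spaces, and for every $n\ge 0$ the map $\mathrm{Fun}_{/B}(S,X)_n\to\mathrm{Fun}_{/B}(A,X)_n$ is a weak equivalence of simplicial sets. -/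

import Mathlib

universe u

open CategoryTheory MonoidalCategory CartesianMonoidalCategory Limits HomotopicalAlgebra Simplicial
open scoped SSet.modelCategoryQuillen

/-! ## Spaces -/

/-- A weak homotopy equivalence of simplicial sets: for every Kan complex `Z`, precomposition with
`f` is a bijection from simplicial homotopy classes of maps `L ⟶ Z` to simplicial homotopy classes
of maps `K ⟶ Z`. (For maps into a Kan complex, simplicial homotopy is an equivalence relation.)
Between Kan complexes these are exactly the simplicial homotopy equivalences. -/
def IsSpaceEquiv {K L : SSet.{u}} (f : K ⟶ L) : Prop :=
  ∀ (Z : SSet.{u}) [SSet.KanComplex Z],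
    (∀ g : K ⟶ Z, ∃ h : L ⟶ Z, Nonempty (SSet.Homotopy (f ≫ h) g)) ∧
    (∀ h h' : L ⟶ Z, Nonempty (SSet.Homotopy (f ≫ h) (f ≫ h')) → Nonempty (SSet.Homotopy h h'))

/-! ## Bisimplicial sets -/

/-- Bisimplicial sets, as simplicial objects in simplicial sets ("simplicial spaces"): the space at
level `n` of `X` is `X.obj (op ⦋n⦌)`. -/
abbrev BiSSet : Type (u + 1) := SimplexCategoryᵒᵖ ⥤ SSet.{u}

noncomputable section

namespace BiSSet

/-- A simplicial set `K` as a constant simplicial space, `(n, m) ↦ K_m`. -/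
abbrev constant : SSet.{u} ⥤ BiSSet.{u} := Functor.const SimplexCategoryᵒᵖ

/-- A simplicial set `K` as a discrete simplicial space, `(n, m) ↦ K_n`. -/
abbrev discrete : SSet.{u} ⥤ BiSSet.{u} :=
  (Functor.whiskeringRight SimplexCategoryᵒᵖ (Type u) SSet.{u}).obj (Functor.const SimplexCategoryᵒᵖ)

/-- The discrete simplicial space `F(n)` represented by `⦋n⦌`. -/
abbrev F : SimplexCategory ⥤ BiSSet.{u} := SSet.stdSimplex.{u} ⋙ discrete

/-- The constant simplicial space on the simplex `Δ[m]`. -/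
abbrev constSimplex : SimplexCategory ⥤ BiSSet.{u} := SSet.stdSimplex.{u} ⋙ constant

/-- The inclusion of `∂F(n)` into `F(n)`. -/
abbrev boundaryIncl (n : ℕ) : discrete.obj (∂Δ[n] : SSet.{u}) ⟶ F.{u}.obj ⦋n⦌ :=
  discrete.map ∂Δ[n].ι

/-- The spine of `Δ[n]`, that is, the union of its edges `{i, i + 1}` (and of its vertices): a
simplex, viewed as a monotone map `s`, belongs to it when `s` takes its values in some `{i, i + 1}`,
that is, when its last value exceeds its first one by at most one. -/
def spine (n : ℕ) : (Δ[n] : SSet.{u}).Subcomplex where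
  obj m := {s | ∀ a b : Fin (m.unop.len + 1),
    (SSet.stdSimplex.asOrderHom s b : ℕ) ≤ (SSet.stdSimplex.asOrderHom s a : ℕ) + 1}
  map φ _ hs a b := hs (φ.unop.toOrderHom a) (φ.unop.toOrderHom b)

/-- The inclusion into `F(n)` of its spine `G(n) = F(1) ∪_{F(0)} ⋯ ∪_{F(0)} F(1)`. -/
abbrev spineIncl (n : ℕ) : discrete.obj (spine.{u} n : SSet.{u}) ⟶ F.{u}.obj ⦋n⦌ :=
  discrete.map (spine n).ι

/-! ### Mapping spaces and internal homs -/

/-- The mapping space `Map(A, X)`, with `Map(A, X)_m = Hom(A × Δ[m], X)`. -/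
@[simps]
def Map (A X : BiSSet.{u}) : SSet.{u} where
  obj m := A ⊗ constSimplex.obj m.unop ⟶ X
  map φ := ↾fun f ↦ A ◁ constSimplex.map φ.unop ≫ f
  map_id m := by
    ext f : 3
    change A ◁ constSimplex.map (𝟙 m.unop) ≫ f = f
    rw [CategoryTheory.Functor.map_id, whiskerLeft_id, Category.id_comp]
  map_comp φ ψ := by
    ext f : 3
    change A ◁ constSimplex.map (ψ.unop ≫ φ.unop) ≫ f = _
    rw [CategoryTheory.Functor.map_comp, whiskerLeft_comp, Category.assoc]
    rfl

/-- Postcomposition `f_* : Map(A, X) ⟶ Map(A, Y)`. -/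
@[simps]
def Map.post (A : BiSSet.{u}) {X Y : BiSSet.{u}} (f : X ⟶ Y) : Map A X ⟶ Map A Y where
  app m := ↾fun g ↦ g ≫ f

/-- Precomposition `i^* : Map(A', X) ⟶ Map(A, X)`. -/
@[simps]
def Map.pre {A A' : BiSSet.{u}} (i : A ⟶ A') (X : BiSSet.{u}) : Map A' X ⟶ Map A X where
  app m := ↾fun g ↦ i ▷ _ ≫ g

/-- The vertex `Δ[0] ⟶ Map(A, X)` given by a map `A ⟶ X`. -/
@[simps]
def Map.vertex {A X : BiSSet.{u}} (p : A ⟶ X) : (Δ[0] : SSet.{u}) ⟶ Map A X where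
  app m := ↾fun _ ↦ fst A _ ≫ p

lemma Map.vertex_pre {A A' X : BiSSet.{u}} (i : A ⟶ A') (p : A' ⟶ X) :
    Map.vertex p ≫ Map.pre i X = Map.vertex (i ≫ p) := by
  ext m x : 4
  exact whiskerRight_fst_assoc i _ p

/-- The internal hom `X^A`, with `(X^A)_n = Map(A × F(n), X)`. -/
@[simps]
def expo (A X : BiSSet.{u}) : BiSSet.{u} where
  obj n := Map (A ⊗ F.obj n.unop) X
  map φ := Map.pre (A ◁ F.map φ.unop) X

/-- Postcomposition `f^A : X^A ⟶ Y^A`. -/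
@[simps]
def expo.post (A : BiSSet.{u}) {X Y : BiSSet.{u}} (f : X ⟶ Y) : expo A X ⟶ expo A Y where
  app n := Map.post (A ⊗ F.obj n.unop) f

/-- Precomposition `X^i : X^A' ⟶ X^A`. -/
@[simps]
def expo.pre {A A' : BiSSet.{u}} (i : A ⟶ A') (X : BiSSet.{u}) : expo A' X ⟶ expo A X where
  app n := Map.pre (i ▷ F.obj n.unop) X

/-- The point `F(0) ⟶ X^A` given by a map `A ⟶ X`. -/
@[simps]
def expo.point {A X : BiSSet.{u}} (p : A ⟶ X) : F.{u}.obj ⦋0⦌ ⟶ expo A X where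
  app n := { app m := ↾fun _ ↦ fst (A ⊗ F.obj n.unop) _ ≫ fst A _ ≫ p }

lemma expo.point_pre {A A' X : BiSSet.{u}} (i : A ⟶ A') (p : A' ⟶ X) :
    expo.point p ≫ expo.pre i X = expo.point (i ≫ p) := by
  ext n m x : 6
  change (i ▷ F.obj n.unop) ▷ _ ≫ fst _ _ ≫ fst _ _ ≫ p = fst _ _ ≫ fst _ _ ≫ i ≫ p
  simp

/-! ### Reedy fibrations and Segal spaces -/

/-- A Reedy fibration of simplicial spaces: for each `n`, the relative matching map
`X_n = Map(F(n), X) ⟶ Map(F(n), Y) ×_{Map(∂F(n), Y)} Map(∂F(n), X)` is a Kan fibration. -/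
def IsReedyFibration {X Y : BiSSet.{u}} (f : X ⟶ Y) : Prop :=
  ∀ n : ℕ, Fibration
    (pullback.lift (f := Map.pre (boundaryIncl n) Y) (g := Map.post _ f)
      (Map.post (F.obj ⦋n⦌) f) (Map.pre (boundaryIncl n) X) rfl)

/-- A Segal space: a Reedy fibrant simplicial space such that, for each `n`, the Segal map
`X_n = Map(F(n), X) ⟶ Map(G(n), X) = X_1 ×_{X_0} ⋯ ×_{X_0} X_1` is an equivalence of spaces. -/
structure IsSegalSpace (X : BiSSet.{u}) : Prop where
  reedyFibrant : IsReedyFibration (toUnit X)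
  segal (n : ℕ) : IsSpaceEquiv (Map.pre (spineIncl n) X)

/-! ### The relative notions -/

variable {B : BiSSet.{u}}

/-- The relative mapping space `Map_{/B}(A, X)`: the fiber of `Map(A, X) ⟶ Map(A, B)` over the
structure map of `A`. -/
def MapOver (A X : Over B) : SSet.{u} :=
  pullback (Map.post A.left X.hom) (Map.vertex A.hom)

/-- The map `Map_{/B}(A', X) ⟶ Map_{/B}(A, X)` induced by `i : A ⟶ A'` over `B`. -/
def MapOver.pre {A A' : Over B} (i : A ⟶ A') (X : Over B) : MapOver A' X ⟶ MapOver A X :=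
  pullback.map _ _ _ _ (Map.pre i.left X.left) (𝟙 _) (Map.pre i.left B)
    rfl
    (by rw [Map.vertex_pre, Over.w, Category.id_comp])

/-- The bisimplicial set of functions `Fun_{/B}(A, X)`: the fiber of `X^A ⟶ B^A` over the
structure map of `A`. -/
def FunOver (A X : Over B) : BiSSet.{u} :=
  pullback (expo.post A.left X.hom) (expo.point A.hom)

/-- The map `Fun_{/B}(A', X) ⟶ Fun_{/B}(A, X)` induced by `i : A ⟶ A'` over `B`. -/
def FunOver.pre {A A' : Over B} (i : A ⟶ A') (X : Over B) : FunOver A' X ⟶ FunOver A X :=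
  pullback.map _ _ _ _ (expo.pre i.left X.left) (𝟙 _) (expo.pre i.left B)
    rfl
    (by rw [expo.point_pre, Over.w, Category.id_comp])

/-- A Segal space over `B`: a Segal space `X` with a Reedy fibration `X ⟶ B`. -/
structure IsSegalSpaceOver (X : Over B) : Prop where
  isSegalSpace : IsSegalSpace X.left
  isReedyFibration : IsReedyFibration X.hom

/-- The map `ι : A ⟶ S` over `B` exhibits `S` as the Segal space completion of `A` relative
to `B`. -/
structure IsSegalCompletion {A S : Over B} (ι : A ⟶ S) : Prop where
  isSegalSpace : IsSegalSpace S.left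
  isSpaceEquiv (X : Over B) (hX : IsSegalSpaceOver X) : IsSpaceEquiv (MapOver.pre ι X)

/-- An equivalence of Segal spaces: a map between Segal spaces that is an equivalence of spaces
at each level. -/
structure IsSegalSpaceEquiv {X Y : BiSSet.{u}} (f : X ⟶ Y) : Prop where
  source : IsSegalSpace X
  target : IsSegalSpace Y
  level (n : SimplexCategoryᵒᵖ) : IsSpaceEquiv (f.app n)

end BiSSet

end

/-! The level `n` of `Fun_{/B}(A, X)` is the fiber of `Map(A × F(n), X) → Map(A × F(n), B)` over the
composite `A × F(n) → A → B`. By currying, it consists of the maps `A → X^{F(n)}` that lie over `A →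
B → B^{F(n)}`, so it is `Map_{/B}(A, Y)` for `Y = X^{F(n)} ×_{B^{F(n)}} B` (`fiberwiseExpo`,
`funOverIso`). This is natural in `A` (`funOverIso_pre`). Once `Y` is known to be a Segal space over
`B`, the universal property of the completion, tested on `Y`, is the claim at level `n`.

That `Y` and the two function objects are Segal spaces follows from three facts: `X^A` is a Segal
space (`IsSegalSpace.expo`), `X^A → B^A` is a Reedy fibration (`IsReedyFibration.expo_post`), and
Segal spaces are stable under base change along Reedy fibrations (`IsSegalSpace.of_isPullback`).

The first fact is the substantial one. For Reedy fibrant `X` the Segal map is a Kan fibration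
between Kan complexes, so it is an equivalence exactly when it is a trivial fibration
(`isTrivialFibration_of_isSpaceEquiv`). The Segal condition thus becomes a lifting property of
pushout-products (`IsOrthogonal`, `isSegalSpace_iff`), and adjunction turns the Segal condition for
`X^A` into orthogonality of `A × G(n) → A × F(n)` to `X → 1`. For `A = F(1)`, the prism is built
from `G(n) × F(1)` by attaching shuffles (`IsLocal.spine_whiskerRight`). Since `F(p + 1)` is a
retract of `F(p) × F(1)`, the case `A = F(p)` follows (`IsSegalSpace.expo_F`). Hence the Reedy
fibration `X^{F(n)} → X^{G(n)}` is a trivial fibration at each level, and a cell-by-cell argument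
(`hasLiftingProperty_of_mono`) makes it orthogonal to every monomorphism, in particular to `∅ → A`.
-/

/-! ## Lifting problems in products -/

section

variable {C : Type*} [Category* C] [MonoidalCategory C]

/-- The lifting property of a pushout-product, in terms of the factors. -/
lemma exists_lift_of_pushoutObjObj {K K' L L' E B : C} {i : K ⟶ K'} {j : L ⟶ L'} {p : E ⟶ B}
    (sq : (curriedTensor C).PushoutObjObj i j) (hp : HasLiftingProperty sq.ι p)
    (u : K' ⊗ L ⟶ E) (v : K ⊗ L' ⟶ E) (w : K' ⊗ L' ⟶ B) (huv : i ▷ L ≫ u = K ◁ j ≫ v)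
    (hu : K' ◁ j ≫ w = u ≫ p) (hv : i ▷ L' ≫ w = v ≫ p) :
    ∃ h : K' ⊗ L' ⟶ E, K' ◁ j ≫ h = u ∧ i ▷ L' ≫ h = v ∧ h ≫ p = w := by
  have h₁ : sq.inl ≫ sq.ι = K' ◁ j := sq.inl_ι
  have h₂ : sq.inr ≫ sq.ι = i ▷ L' := sq.inr_ι
  have h₃ : sq.inl ≫ sq.isPushout.desc u v huv = u := sq.isPushout.inl_desc _ _ _
  have h₄ : sq.inr ≫ sq.isPushout.desc u v huv = v := sq.isPushout.inr_desc _ _ _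
  have s : CommSq (sq.isPushout.desc u v huv) sq.ι p w := ⟨by
    apply sq.isPushout.hom_ext
    · rw [reassoc_of% h₃, reassoc_of% h₁, hu]
    · rw [reassoc_of% h₄, reassoc_of% h₂, hv]⟩
  refine ⟨s.lift, ?_, ?_, s.fac_right⟩
  · rw [← h₁, Category.assoc, s.fac_left, h₃]
  · rw [← h₂, Category.assoc, s.fac_left, h₄]

end

/-! ### Kan fibrations, trivial fibrations and homotopy lifting -/

namespace SSet

open modelCategoryQuillen

/-- A trivial Kan fibration. -/
abbrev IsTrivialFibration {E B : SSet.{u}} (p : E ⟶ B) : Prop := I.rlp p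

lemma IsTrivialFibration.hasLiftingProperty {E B K L : SSet.{u}} {p : E ⟶ B}
    (hp : IsTrivialFibration p) (i : K ⟶ L) [Mono i] : HasLiftingProperty i p := by
  rw [IsTrivialFibration, ← rlp_monomorphisms] at hp
  exact hp _ (.infer_property _)

lemma anodyneExtensions.hasLiftingProperty {E B K L : SSet.{u}} {i : K ⟶ L}
    (hi : anodyneExtensions i) (p : E ⟶ B) [Fibration p] : HasLiftingProperty i p :=
  hi _ (HomotopicalAlgebra.mem_fibrations p)

lemma range_δ_one : (Subcomplex.range (stdSimplex.{u}.δ (1 : Fin 2))) = Λ[1, 0] := by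
  rw [stdSimplex.range_δ, horn_eq_iSup]
  apply le_antisymm
  · exact le_iSup_of_le ⟨1, by simp⟩ (by rfl)
  · rw [iSup_le_iff]
    rintro ⟨j, hj⟩
    obtain rfl : j = 1 := by
      fin_cases j
      · simp at hj
      · rfl
    rfl

lemma anodyneExtensions_δ_one : anodyneExtensions (stdSimplex.{u}.δ (1 : Fin 2)) := by
  have : anodyneExtensions (Subcomplex.range (stdSimplex.{u}.δ (1 : Fin 2))).ι := by
    rw [range_δ_one]
    exact .horn_ι 0
  exact MorphismProperty.comp_mem _ (Subcomplex.toRange (stdSimplex.{u}.δ (1 : Fin 2))) _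
    (.of_isIso _) this

lemma whiskerLeft_δ_one (K : SSet.{u}) :
    K ◁ stdSimplex.δ (1 : Fin 2) = fst K Δ[0] ≫ ι₀ := by
  rw [stdSimplex.δ_one_eq_const]
  rfl

lemma whiskerLeft_δ_zero (K : SSet.{u}) :
    K ◁ stdSimplex.δ (0 : Fin 2) = fst K Δ[0] ≫ ι₁ := by
  rw [stdSimplex.δ_zero_eq_const]
  rfl

/-- The relative homotopy lifting property. -/
lemma exists_homotopy_lift {K L E B : SSet.{u}} (i : K ⟶ L) [Mono i] (p : E ⟶ B) [Fibration p]
    (u : L ⟶ E) (G : K ⊗ Δ[1] ⟶ E) (H : L ⊗ Δ[1] ⟶ B)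
    (hG : ι₀ ≫ G = i ≫ u) (hH : ι₀ ≫ H = u ≫ p) (hGH : i ▷ _ ≫ H = G ≫ p) :
    ∃ H' : L ⊗ Δ[1] ⟶ E, ι₀ ≫ H' = u ∧ i ▷ _ ≫ H' = G ∧ H' ≫ p = H := by
  let sq := Functor.PushoutObjObj.ofHasPushout (curriedTensor SSet.{u}) i
    (stdSimplex.δ (1 : Fin 2))
  have hp : HasLiftingProperty sq.ι p :=
    (anodyneExtensions_pushoutObjObjι sq anodyneExtensions_δ_one).hasLiftingProperty p
  obtain ⟨h, h₁, h₂, h₃⟩ := exists_lift_of_pushoutObjObj sq hp (fst _ _ ≫ u) G H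
    (by rw [whiskerLeft_δ_one, Category.assoc, hG]; rfl)
    (by rw [whiskerLeft_δ_one, Category.assoc, hH, Category.assoc]) hGH
  refine ⟨h, ?_, h₂, h₃⟩
  have := congr(lift (𝟙 L) (stdSimplex.isTerminalObj₀.from L) ≫ $h₁)
  rw [whiskerLeft_δ_one] at this
  simpa using this

lemma mem_boundary_one_iff {m} (s : (Δ[1] : SSet.{u}).obj m) :
    s ∈ (∂Δ[1]).obj m ↔ s = stdSimplex.const 1 0 m ∨ s = stdSimplex.const 1 1 m := by
  have key (c : Fin 2) : s = stdSimplex.const 1 c m ↔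
      ∀ i, stdSimplex.asOrderHom s i = c := by
    refine ⟨fun h i ↦ by rw [h]; rfl, fun h ↦ stdSimplex.objEquiv.injective ?_⟩
    ext i : 3
    exact h i
  rw [key, key]
  change ¬ Function.Surjective (stdSimplex.asOrderHom s) ↔ _
  generalize stdSimplex.asOrderHom s = f
  constructor
  · intro h
    by_contra! h'
    obtain ⟨⟨i, hi⟩, ⟨j, hj⟩⟩ := h'
    refine h (Fin.forall_fin_two.2 ⟨⟨j, ?_⟩, ⟨i, ?_⟩⟩)
    · have : ∀ x : Fin 2, x ≠ 1 → x = 0 := by decide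
      exact this _ hj
    · have : ∀ x : Fin 2, x ≠ 0 → x = 1 := by decide
      exact this _ hi
  · rintro (h | h) h'
    · obtain ⟨i, hi⟩ := h' 1
      exact absurd ((h i).symm.trans hi) (show (0 : Fin 2) ≠ 1 by decide)
    · obtain ⟨i, hi⟩ := h' 0
      exact absurd ((h i).symm.trans hi) (show (1 : Fin 2) ≠ 0 by decide)

lemma hom_ext_tensor_boundary_one {K E : SSet.{u}} {c c' : K ⊗ (∂Δ[1] : SSet.{u}) ⟶ E}
    (h₀ : K ◁ boundary.ι (1 : Fin 2) ≫ c = K ◁ boundary.ι (1 : Fin 2) ≫ c')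
    (h₁ : K ◁ boundary.ι (0 : Fin 2) ≫ c = K ◁ boundary.ι (0 : Fin 2) ≫ c') : c = c' := by
  ext m ⟨k, ⟨s, hs⟩⟩
  let t : (Δ[0] : SSet.{u}).obj m := stdSimplex.const 0 0 m
  let z : (K ⊗ (Δ[0] : SSet.{u})).obj m := (k, t)
  obtain rfl | rfl := (mem_boundary_one_iff s).1 hs
  · have : (⟨_, hs⟩ : (∂Δ[1] : SSet.{u}).obj m) = (boundary.ι (1 : Fin 2)).app m t := by
      apply Subtype.ext
      change _ = (boundary.ι (1 : Fin 2) ≫ ∂Δ[1].ι).app m t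
      rw [boundary.ι_ι, stdSimplex.δ_one_eq_const]
      rfl
    rw [this]
    exact ConcreteCategory.congr_hom (NatTrans.congr_app h₀ m) z
  · have : (⟨_, hs⟩ : (∂Δ[1] : SSet.{u}).obj m) = (boundary.ι (0 : Fin 2)).app m t := by
      apply Subtype.ext
      change _ = (boundary.ι (0 : Fin 2) ≫ ∂Δ[1].ι).app m t
      rw [boundary.ι_ι, stdSimplex.δ_zero_eq_const]
      rfl
    rw [this]
    exact ConcreteCategory.congr_hom (NatTrans.congr_app h₁ m) z

/-- Two maps `K ⟶ E` glue to a map `K ⊗ ∂Δ[1] ⟶ E`. -/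
lemma exists_map_boundary_one {K E : SSet.{u}} (a b : K ⟶ E) :
    ∃ c : K ⊗ (∂Δ[1] : SSet.{u}) ⟶ E, K ◁ boundary.ι (1 : Fin 2) ≫ c = fst _ _ ≫ a ∧
      K ◁ boundary.ι (0 : Fin 2) ≫ c = fst _ _ ≫ b := by
  classical
  have hne (m) : (stdSimplex.const 1 1 m : (Δ[1] : SSet.{u}).obj m) ≠ stdSimplex.const 1 0 m := by
    intro h
    have := congr(stdSimplex.asOrderHom $h 0)
    exact absurd this (show (1 : Fin 2) ≠ 0 by simp)
  let c : K ⊗ (∂Δ[1] : SSet.{u}) ⟶ E :=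
    { app m := ↾fun z ↦ if z.2.1 = stdSimplex.const 1 0 m then a.app m z.1 else b.app m z.1
      naturality m m' f := by
        ext ⟨k, ⟨s, hs⟩⟩
        obtain rfl | rfl := (mem_boundary_one_iff s).1 hs
        · change (if stdSimplex.const 1 0 m' = stdSimplex.const 1 0 m' then _ else _) =
            E.map f (if stdSimplex.const 1 0 m = stdSimplex.const 1 0 m then _ else _)
          rw [if_pos rfl, if_pos rfl]
          exact ConcreteCategory.congr_hom (a.naturality f) k
        · change (if stdSimplex.const 1 1 m' = stdSimplex.const 1 0 m' then _ else _) =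
            E.map f (if stdSimplex.const 1 1 m = stdSimplex.const 1 0 m then _ else _)
          rw [if_neg (hne _), if_neg (hne _)]
          exact ConcreteCategory.congr_hom (b.naturality f) k }
  refine ⟨c, ?_, ?_⟩
  · ext m ⟨k, t⟩
    have ht : (boundary.ι (1 : Fin 2) ≫ ∂Δ[1].ι).app m t = stdSimplex.const 1 0 m := by
      rw [boundary.ι_ι, stdSimplex.δ_one_eq_const]
      rfl
    exact if_pos ht
  · ext m ⟨k, t⟩
    have ht : (boundary.ι (0 : Fin 2) ≫ ∂Δ[1].ι).app m t = stdSimplex.const 1 1 m := by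
      rw [boundary.ι_ι, stdSimplex.δ_zero_eq_const]
      rfl
    exact if_neg (fun e ↦ hne m (ht.symm.trans e))

/-- Homotopies relative to a subcomplex can be lifted along a trivial fibration. -/
lemma IsTrivialFibration.exists_homotopy {L E B : SSet.{u}} (K : L.Subcomplex) {p : E ⟶ B}
    (hp : IsTrivialFibration p) (a b : L ⟶ E) (G : (K : SSet.{u}) ⊗ Δ[1] ⟶ E) (H : L ⊗ Δ[1] ⟶ B)
    (hG₀ : ι₀ ≫ G = K.ι ≫ a) (hG₁ : ι₁ ≫ G = K.ι ≫ b) (hH₀ : ι₀ ≫ H = a ≫ p)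
    (hH₁ : ι₁ ≫ H = b ≫ p) (hGH : K.ι ▷ _ ≫ H = G ≫ p) :
    ∃ H' : L ⊗ Δ[1] ⟶ E, ι₀ ≫ H' = a ∧ ι₁ ≫ H' = b ∧ K.ι ▷ _ ≫ H' = G ∧ H' ≫ p = H := by
  obtain ⟨c, h₀, h₁⟩ := exists_map_boundary_one a b
  have e₀ (M : SSet.{u}) : M ◁ boundary.ι (1 : Fin 2) ≫ M ◁ ∂Δ[1].ι = fst _ _ ≫ ι₀ := by
    rw [← whiskerLeft_comp, boundary.ι_ι, whiskerLeft_δ_one]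
  have e₁ (M : SSet.{u}) : M ◁ boundary.ι (0 : Fin 2) ≫ M ◁ ∂Δ[1].ι = fst _ _ ≫ ι₁ := by
    rw [← whiskerLeft_comp, boundary.ι_ι, whiskerLeft_δ_zero]
  have w₁ : K.ι ▷ (∂Δ[1] : SSet.{u}) ≫ c = (K : SSet.{u}) ◁ ∂Δ[1].ι ≫ G := by
    apply hom_ext_tensor_boundary_one
    · rw [reassoc_of% e₀, hG₀, whisker_exchange_assoc, h₀, whiskerRight_fst_assoc]
    · rw [reassoc_of% e₁, hG₁, whisker_exchange_assoc, h₁, whiskerRight_fst_assoc]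
  have w₂ : L ◁ ∂Δ[1].ι ≫ H = c ≫ p := by
    apply hom_ext_tensor_boundary_one
    · rw [reassoc_of% e₀, hH₀, reassoc_of% h₀]
    · rw [reassoc_of% e₁, hH₁, reassoc_of% h₁]
  obtain ⟨h, hc, h₂, h₃⟩ := exists_lift_of_pushoutObjObj
    (Subcomplex.unionProd.pushoutObjObj K ∂Δ[1]) (hp.hasLiftingProperty (K.unionProd ∂Δ[1]).ι)
    c G H w₁ w₂ hGH
  refine ⟨h, ?_, ?_, h₂, h₃⟩
  · have := congr(lift (𝟙 L) (stdSimplex.isTerminalObj₀.from L) ≫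
      L ◁ boundary.ι (1 : Fin 2) ≫ $hc)
    rw [reassoc_of% e₀, h₀] at this
    simpa using this
  · have := congr(lift (𝟙 L) (stdSimplex.isTerminalObj₀.from L) ≫
      L ◁ boundary.ι (0 : Fin 2) ≫ $hc)
    rw [reassoc_of% e₁, h₁] at this
    simpa using this

/-- A lift against `p ≫ q` is correct on the boundary but lies over the given simplex of `B` only
after applying `q`. Triviality of `q` gives a homotopy relative to the boundary that repairs this,
and the fibration `p` lifts that homotopy. -/
lemma IsTrivialFibration.of_comp {E B C : SSet.{u}} (p : E ⟶ B) [Fibration p] (q : B ⟶ C)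
    (hq : IsTrivialFibration q) (hpq : IsTrivialFibration (p ≫ q)) : IsTrivialFibration p := by
  rintro _ _ _ ⟨n⟩
  refine ⟨fun {u v} sq ↦ ?_⟩
  have := hpq.hasLiftingProperty ∂Δ[n].ι
  have sq' : CommSq u ∂Δ[n].ι (p ≫ q) (v ≫ q) := ⟨by rw [reassoc_of% sq.w]⟩
  obtain ⟨H, h₀, h₁, h₂, -⟩ := hq.exists_homotopy ∂Δ[n] (sq'.lift ≫ p) v
    (fst _ _ ≫ u ≫ p) (fst _ _ ≫ v ≫ q)
    (by rw [reassoc_of% ι₀_fst, sq'.fac_left_assoc]) (by rw [reassoc_of% ι₁_fst, sq.w])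
    (by rw [reassoc_of% ι₀_fst, Category.assoc, sq'.fac_right]) (by rw [reassoc_of% ι₁_fst])
    (by rw [whiskerRight_fst_assoc, Category.assoc, Category.assoc, reassoc_of% sq.w])
  obtain ⟨H', h₀', h₁', h₂'⟩ := exists_homotopy_lift ∂Δ[n].ι p sq'.lift (fst _ _ ≫ u) H
    (by rw [reassoc_of% ι₀_fst, sq'.fac_left]) h₀ (by rw [h₂, Category.assoc])
  exact ⟨⟨{ l := ι₁ ≫ H'
            fac_left := by rw [← ι₁_comp_assoc, h₁', reassoc_of% ι₁_fst]
            fac_right := by rw [Category.assoc, h₂', h₁] }⟩⟩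

/-! ### Simplicial homotopies and weak equivalences -/

/-- The homotopy given by a map `K ⊗ Δ[1] ⟶ Z`. -/
def Homotopy.ofMap {K Z : SSet.{u}} (H : K ⊗ Δ[1] ⟶ Z) {a b : K ⟶ Z} (h₀ : ι₀ ≫ H = a)
    (h₁ : ι₁ ≫ H = b) : Homotopy a b where
  h := H
  h₀ := h₀
  h₁ := h₁
  rel := by
    ext m ⟨⟨_, hx⟩, _⟩
    exact hx.elim

lemma Homotopy.nonempty_iff {K Z : SSet.{u}} {a b : K ⟶ Z} :
    Nonempty (Homotopy a b) ↔ ∃ H : K ⊗ Δ[1] ⟶ Z, ι₀ ≫ H = a ∧ ι₁ ≫ H = b :=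
  ⟨fun ⟨H⟩ ↦ ⟨H.h, H.h₀, H.h₁⟩, fun ⟨H, h₀, h₁⟩ ↦ ⟨.ofMap H h₀ h₁⟩⟩

lemma Homotopy.nonempty_precomp {K L Z : SSet.{u}} (c : K ⟶ L) {a b : L ⟶ Z}
    (h : Nonempty (Homotopy a b)) : Nonempty (Homotopy (c ≫ a) (c ≫ b)) := by
  rw [nonempty_iff] at h ⊢
  obtain ⟨H, rfl, rfl⟩ := h
  exact ⟨c ▷ _ ≫ H, by rw [ι₀_comp_assoc], by rw [ι₁_comp_assoc]⟩

/-- Lifting against `∅ → B` gives a section `s`, and lifting a constant homotopy gives `p ≫ s ∼ 𝟙`;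
so `s` is a homotopy inverse. -/
lemma IsTrivialFibration.isSpaceEquiv {E B : SSet.{u}} {p : E ⟶ B} (hp : IsTrivialFibration p) :
    IsSpaceEquiv p := by
  have := hp.hasLiftingProperty (initial.to B)
  have sq : CommSq (initial.to E) (initial.to B) p (𝟙 B) := ⟨Subsingleton.elim _ _⟩
  have hs : sq.lift ≫ p = 𝟙 B := sq.fac_right
  generalize sq.lift = s at hs
  obtain ⟨H, h₀, h₁, -, -⟩ := hp.exists_homotopy ⊥ (p ≫ s) (𝟙 E)
    (fst _ _ ≫ Subcomplex.isInitialBot.to _) (fst _ _ ≫ p) (Subsingleton.elim _ _)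
    (Subsingleton.elim _ _) (by simp [hs]) (by simp) (by
      rw [whiskerRight_fst_assoc, Category.assoc]
      congr 1
      exact Subsingleton.elim _ _)
  intro Z _
  refine ⟨fun g ↦ ⟨s ≫ g, ?_⟩, fun h h' ⟨H'⟩ ↦ ?_⟩
  · rw [Homotopy.nonempty_iff]
    exact ⟨H ≫ g, by simp [reassoc_of% h₀], by simp [reassoc_of% h₁]⟩
  · rw [Homotopy.nonempty_iff]
    refine ⟨s ▷ _ ≫ H'.h, ?_, ?_⟩
    · rw [ι₀_comp_assoc, H'.h₀, reassoc_of% hs]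
    · rw [ι₁_comp_assoc, H'.h₁, reassoc_of% hs]

/-- Filling of a horn `Λ[2, 0]` in a family. -/
lemma exists_horn_two_zero_filler {K E B : SSet.{u}} (p : E ⟶ B) [Fibration p]
    (G G' : K ⊗ Δ[1] ⟶ E) (T : K ⊗ Δ[2] ⟶ B) (h₀ : ι₀ ≫ G = ι₀ ≫ G')
    (hG : K ◁ stdSimplex.δ (2 : Fin 3) ≫ T = G ≫ p)
    (hG' : K ◁ stdSimplex.δ (1 : Fin 3) ≫ T = G' ≫ p) :
    ∃ G'' : K ⊗ Δ[1] ⟶ E, ι₀ ≫ G'' = ι₁ ≫ G ∧ ι₁ ≫ G'' = ι₁ ≫ G' ∧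
      G'' ≫ p = K ◁ stdSimplex.δ (0 : Fin 3) ≫ T := by
  have sq := (horn₂₀.isPushout.{u}).map (tensorLeft K)
  have : HasLiftingProperty (K ◁ Λ[2, 0].ι) p :=
    ((anodyneExtensions.horn_ι (0 : Fin 3)).whiskerLeft K).hasLiftingProperty p
  have hw : K ◁ stdSimplex.δ (1 : Fin 2) ≫ G = K ◁ stdSimplex.δ (1 : Fin 2) ≫ G' := by
    rw [whiskerLeft_δ_one, Category.assoc, Category.assoc, h₀]
  have e₁ : K ◁ horn₂₀.ι₀₁ ≫ K ◁ Λ[2, 0].ι = K ◁ stdSimplex.δ (2 : Fin 3) := by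
    rw [← whiskerLeft_comp, horn.ι_ι]
  have e₂ : K ◁ horn₂₀.ι₀₂ ≫ K ◁ Λ[2, 0].ι = K ◁ stdSimplex.δ (1 : Fin 3) := by
    rw [← whiskerLeft_comp, horn.ι_ι]
  have f₁ : K ◁ horn₂₀.ι₀₁ ≫ sq.desc G G' hw = G := sq.inl_desc _ _ _
  have f₂ : K ◁ horn₂₀.ι₀₂ ≫ sq.desc G G' hw = G' := sq.inr_desc _ _ _
  have s : CommSq (sq.desc G G' hw) (K ◁ Λ[2, 0].ι) p T := ⟨by
    apply sq.hom_ext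
    · rw [sq.inl_desc_assoc]
      exact hG.symm.trans (by rw [← e₁]; rfl)
    · rw [sq.inr_desc_assoc]
      exact hG'.symm.trans (by rw [← e₂]; rfl)⟩
  obtain ⟨l, g₁, g₂, g₃⟩ : ∃ l : K ⊗ Δ[2] ⟶ E, K ◁ stdSimplex.δ (2 : Fin 3) ≫ l = G ∧
      K ◁ stdSimplex.δ (1 : Fin 3) ≫ l = G' ∧ l ≫ p = T :=
    ⟨s.lift, by rw [← e₁, Category.assoc, s.fac_left, f₁],
      by rw [← e₂, Category.assoc, s.fac_left, f₂], s.fac_right⟩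
  have c₀ (L M : SSet.{u}) (x y : Δ[1] ⟶ L) (i j : Fin 2)
      (hxy : stdSimplex.δ i ≫ x = stdSimplex.δ j ≫ y) (f : K ⊗ L ⟶ M) :
      K ◁ stdSimplex.δ i ≫ K ◁ x ≫ f = K ◁ stdSimplex.δ j ≫ K ◁ y ≫ f := by
    rw [← whiskerLeft_comp_assoc, hxy, whiskerLeft_comp_assoc]
  have key {M : SSet.{u}} {a b : K ⟶ M} (h : fst K Δ[0] ≫ a = fst K Δ[0] ≫ b) : a = b := by
    simpa using congr(lift (𝟙 K) (stdSimplex.isTerminalObj₀.from K) ≫ $h)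
  refine ⟨K ◁ stdSimplex.δ (0 : Fin 3) ≫ l, key ?_, key ?_, by rw [Category.assoc, g₃]⟩
  · rw [← g₁, ← reassoc_of% whiskerLeft_δ_one, ← reassoc_of% whiskerLeft_δ_zero]
    exact c₀ _ _ _ _ _ _ (stdSimplex.δ_comp_δ (i := (0 : Fin 2)) (j := 1) (by simp)).symm _
  · rw [← g₂, ← reassoc_of% whiskerLeft_δ_zero, ← reassoc_of% whiskerLeft_δ_zero]
    exact c₀ _ _ _ _ _ _ (stdSimplex.δ_comp_δ (i := (0 : Fin 2)) (j := 0) (by simp)).symm _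

/-- A Kan fibration between Kan complexes which is an equivalence is a trivial fibration. -/
theorem isTrivialFibration_of_isSpaceEquiv {E B : SSet.{u}} [KanComplex E] [KanComplex B]
    (p : E ⟶ B) [Fibration p] (hp : IsSpaceEquiv p) : IsTrivialFibration p := by
  -- Testing the equivalence on the Kan complexes `E` and `B` produces a homotopy inverse `h`.
  obtain ⟨h, ⟨H₀⟩⟩ := (hp E).1 (𝟙 E)
  obtain ⟨K⟩ := (hp B).2 (h ≫ p) (𝟙 B) (Homotopy.nonempty_iff.2 ⟨H₀.h ≫ p,
    by rw [reassoc_of% H₀.h₀], by rw [reassoc_of% H₀.h₁, Category.comp_id]⟩)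
  -- Lifting the homotopy `h ≫ p ∼ 𝟙` along `p`, from `h`, replaces `h` by a strict section `s`.
  obtain ⟨K', k₀, -, k₂⟩ := exists_homotopy_lift (⊥ : B.Subcomplex).ι p h
    (fst _ _ ≫ Subcomplex.isInitialBot.to _) K.h (Subsingleton.elim _ _) K.h₀ (by
      ext m ⟨⟨_, hx⟩, _⟩
      exact hx.elim)
  obtain ⟨s, hs⟩ : ∃ s, ι₁ ≫ K' = s := ⟨_, rfl⟩
  have hsp : s ≫ p = 𝟙 B := by rw [← hs, Category.assoc, k₂, K.h₁]
  -- Both `p ≫ s` and `𝟙` are targets of homotopies from `p ≫ h`; a horn filler in `E` joins them.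
  obtain ⟨H, hH₀, hH₁, -⟩ := exists_horn_two_zero_filler (terminal.from E) (p ▷ _ ≫ K') H₀.h
    (terminal.from _) (by rw [ι₀_comp_assoc, k₀, H₀.h₀]) (Subsingleton.elim _ _)
    (Subsingleton.elim _ _)
  rw [ι₁_comp_assoc, hs] at hH₀
  rw [H₀.h₁] at hH₁
  have e₂ : stdSimplex.δ (2 : Fin 3) ≫ stdSimplex.σ (1 : Fin 2) = 𝟙 Δ[1] :=
    stdSimplex.δ_comp_σ_succ (i := (1 : Fin 2))
  have e₁ : stdSimplex.δ (1 : Fin 3) ≫ stdSimplex.σ (1 : Fin 2) = 𝟙 Δ[1] :=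
    stdSimplex.δ_comp_σ_self (i := (1 : Fin 2))
  have e₀ : stdSimplex.δ (0 : Fin 3) ≫ stdSimplex.σ (1 : Fin 2) =
      stdSimplex.σ (0 : Fin 1) ≫ stdSimplex.δ (0 : Fin 2) :=
    stdSimplex.δ_comp_σ_of_le (i := (0 : Fin 2)) (j := (0 : Fin 1)) (by simp)
  -- `H` need not be vertical. The homotopies `H ≫ p ≫ s` and `H` have the same source and the same
  -- image in `B`, so filling over a degenerate triangle gives a homotopy `G` from `p ≫ s` to `𝟙`
  -- that is constant over `B`.
  obtain ⟨G, hG₀, hG₁, hG₂⟩ := exists_horn_two_zero_filler p (H ≫ p ≫ s) H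
    (E ◁ stdSimplex.σ (1 : Fin 2) ≫ H ≫ p)
    (by rw [reassoc_of% hH₀, reassoc_of% hsp, hH₀])
    (by rw [← whiskerLeft_comp_assoc, e₂, whiskerLeft_id, Category.id_comp, Category.assoc,
      Category.assoc, hsp, Category.comp_id])
    (by rw [← whiskerLeft_comp_assoc, e₁, whiskerLeft_id, Category.id_comp])
  rw [reassoc_of% hH₁] at hG₀
  rw [hH₁] at hG₁
  rw [← whiskerLeft_comp_assoc, e₀, whiskerLeft_comp_assoc, reassoc_of% whiskerLeft_δ_zero,
    reassoc_of% hH₁, whiskerLeft_fst_assoc] at hG₂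
  rintro _ _ _ ⟨n⟩
  refine ⟨fun {a b} sq ↦ ?_⟩
  -- The candidate `b ≫ s` is wrong on the boundary by `a ≫ p ≫ s` versus `a`; the vertical homotopy
  -- `G` moves it to a true lift.
  obtain ⟨F, f₀, f₁, f₂⟩ := exists_homotopy_lift ∂Δ[n].ι p (b ≫ s) (a ▷ _ ≫ G) (fst _ _ ≫ b)
    (by rw [ι₀_comp_assoc, hG₀, reassoc_of% sq.w])
    (by rw [reassoc_of% ι₀_fst, Category.assoc, hsp, Category.comp_id])
    (by rw [whiskerRight_fst_assoc, Category.assoc, hG₂, whiskerRight_fst_assoc, sq.w])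
  exact ⟨⟨{ l := ι₁ ≫ F
            fac_left := by rw [← ι₁_comp_assoc, f₁, ι₁_comp_assoc, hG₁, Category.comp_id]
            fac_right := by rw [Category.assoc, f₂, reassoc_of% ι₁_fst] }⟩⟩

end SSet

lemma IsSpaceEquiv.of_iso {K L K' L' : SSet.{u}} {f : K ⟶ L} {g : K' ⟶ L'} (hg : IsSpaceEquiv g)
    (a : K ≅ K') (b : L ≅ L') (w : a.hom ≫ g = f ≫ b.hom) : IsSpaceEquiv f := by
  have w' : a.inv ≫ f = g ≫ b.inv := by
    rw [Iso.inv_comp_eq, ← Category.assoc, w, Category.assoc, Iso.hom_inv_id, Category.comp_id]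
  refine fun Z _ ↦ ⟨fun k ↦ ?_, fun h h' H ↦ ?_⟩
  · obtain ⟨h, H⟩ := (hg Z).1 (a.inv ≫ k)
    refine ⟨b.hom ≫ h, ?_⟩
    have := SSet.Homotopy.nonempty_precomp a.hom H
    rwa [Iso.hom_inv_id_assoc, reassoc_of% w] at this
  · have := SSet.Homotopy.nonempty_precomp b.hom ((hg Z).2 (b.inv ≫ h) (b.inv ≫ h') (by
      rw [← reassoc_of% w', ← reassoc_of% w']
      exact SSet.Homotopy.nonempty_precomp a.inv H))
    rwa [Iso.hom_inv_id_assoc, Iso.hom_inv_id_assoc] at this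

noncomputable section

/-! ### Bisimplices and the internal hom of bisimplicial sets -/

namespace BiSSet

open Opposite

lemma hom_ext {X Y : BiSSet.{u}} {f g : X ⟶ Y}
    (h : ∀ (n m : SimplexCategory) (x : (X.obj (op n)).obj (op m)),
      (f.app (op n)).app (op m) x = (g.app (op n)).app (op m) x) : f = g := by
  ext n m x
  exact h n.unop m.unop x

/-- The map from the bisimplex that corresponds to an element of a bisimplicial set. -/
def cell {X : BiSSet.{u}} {n m : SimplexCategory} (x : (X.obj (op n)).obj (op m)) :
    F.{u}.obj n ⊗ constSimplex.{u}.obj m ⟶ X where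
  app n' :=
    { app m' := ↾fun z ↦ (X.map (SSet.stdSimplex.objEquiv z.1).op).app m'
        ((X.obj (op n)).map (SSet.stdSimplex.objEquiv z.2).op x)
      naturality m' m'' f := by
        ext z
        change (X.map (SSet.stdSimplex.objEquiv z.1).op).app m''
          ((X.obj (op n)).map ((SSet.stdSimplex.objEquiv z.2).op ≫ f) x) =
            (X.obj n').map f ((X.map (SSet.stdSimplex.objEquiv z.1).op).app m' _)
        rw [← NatTrans.naturality_apply, Functor.map_comp_apply] }
  naturality n' n'' f := by
    ext m z
    change (X.map ((SSet.stdSimplex.objEquiv z.1).op ≫ f)).app m _ = (X.map f).app m _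
    rw [Functor.map_comp]
    rfl

lemma cell_app {X : BiSSet.{u}} {n m n' m' : SimplexCategory} (x : (X.obj (op n)).obj (op m))
    (s : n' ⟶ n) (t : m' ⟶ m) :
    ((cell x).app (op n')).app (op m')
      (SSet.stdSimplex.objEquiv.symm s, SSet.stdSimplex.objEquiv.symm t) =
      (X.map s.op).app (op m') ((X.obj (op n)).map t.op x) := rfl

lemma F_map_cell {X : BiSSet.{u}} {n n' m : SimplexCategory} (x : (X.obj (op n)).obj (op m))
    (s : n' ⟶ n) :
    F.map s ▷ constSimplex.obj m ≫ cell x = cell ((X.map s.op).app (op m) x) := by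
  ext a b z
  change (X.map (s.op ≫ (SSet.stdSimplex.objEquiv z.1).op)).app b _ =
    (X.map _).app b ((X.obj _).map _ ((X.map s.op).app (op m) x))
  rw [← NatTrans.naturality_apply, Functor.map_comp]
  rfl

lemma constSimplex_map_cell {X : BiSSet.{u}} {n m m' : SimplexCategory}
    (x : (X.obj (op n)).obj (op m)) (t : m' ⟶ m) :
    F.obj n ◁ constSimplex.map t ≫ cell x = cell ((X.obj (op n)).map t.op x) := by
  ext a b z
  change (X.map _).app b ((X.obj (op n)).map (t.op ≫ (SSet.stdSimplex.objEquiv z.2).op) x) =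
    (X.map _).app b _
  rw [Functor.map_comp_apply]
  rfl

lemma cell_app_id {X : BiSSet.{u}} {n m : SimplexCategory} (x : (X.obj (op n)).obj (op m)) :
    ((cell x).app (op n)).app (op m)
      (SSet.stdSimplex.objEquiv.symm (𝟙 n), SSet.stdSimplex.objEquiv.symm (𝟙 m)) = x := by
  rw [cell_app, op_id, op_id, Functor.map_id_apply, CategoryTheory.Functor.map_id]
  rfl

/-- The value of a map out of `(A ⊗ F n) ⊗ Δ[m]`. -/
abbrev evalAt {A X : BiSSet.{u}} {n m n' m' : SimplexCategory}
    (φ : (A ⊗ F.obj n) ⊗ constSimplex.obj m ⟶ X) (a : (A.obj (op n')).obj (op m'))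
    (s : n' ⟶ n) (t : m' ⟶ m) : (X.obj (op n')).obj (op m') :=
  (φ.app (op n')).app (op m')
    ((a, SSet.stdSimplex.objEquiv.symm s), SSet.stdSimplex.objEquiv.symm t)

lemma expo_app_map_left {A K X : BiSSet.{u}} (ψ : K ⟶ expo A X) {n n' m : SimplexCategory}
    (f : n' ⟶ n) (k : (K.obj (op n)).obj (op m)) :
    (ψ.app (op n')).app (op m) ((K.map f.op).app (op m) k) =
      ((A ◁ F.map f) ▷ constSimplex.obj m ≫ (ψ.app (op n)).app (op m) k :) :=
  congr(($(ψ.naturality f.op)).app (op m) k)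

lemma expo_app_map_right {A K X : BiSSet.{u}} (ψ : K ⟶ expo A X) {n m m' : SimplexCategory}
    (f : m' ⟶ m) (k : (K.obj (op n)).obj (op m)) :
    (ψ.app (op n)).app (op m') ((K.obj (op n)).map f.op k) =
      ((A ⊗ F.obj n) ◁ constSimplex.map f ≫ (ψ.app (op n)).app (op m) k :) :=
  NatTrans.naturality_apply (ψ.app (op n)) f.op k

/-- Currying for the internal hom of bisimplicial sets. -/
def expoHomEquiv (A K X : BiSSet.{u}) : (A ⊗ K ⟶ X) ≃ (K ⟶ expo A X) where
  toFun φ :=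
    { app n :=
        { app m := ↾fun k ↦ (α_ _ _ _).hom ≫ A ◁ cell (X := K) (n := n.unop) (m := m.unop) k ≫ φ
          naturality m m' f := by
            ext k
            change _ ≫ A ◁ cell ((K.obj n).map f.unop.op k) ≫ φ =
              (A ⊗ F.obj n.unop) ◁ constSimplex.map f.unop ≫ _ ≫ _ ≫ _
            rw [← constSimplex_map_cell]
            simp }
      naturality n n' f := by
        ext m k
        change _ ≫ A ◁ cell ((K.map f.unop.op).app (op m.unop) k) ≫ φ =
          (A ◁ F.map f.unop) ▷ constSimplex.obj m.unop ≫ _ ≫ _ ≫ _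
        rw [← F_map_cell]
        simp }
  invFun ψ :=
    { app n :=
        { app m := ↾fun z ↦ evalAt (n := n.unop) (m := m.unop) ((ψ.app n).app m z.2) z.1 (𝟙 _) (𝟙 _)
          naturality m m' f := by
            ext z
            change evalAt ((ψ.app n).app (op m'.unop) ((K.obj n).map f.unop.op z.2)) _ (𝟙 _) (𝟙 _) =
              (X.obj n).map f _
            rw [expo_app_map_right ψ f.unop z.2]
            let φ : (A ⊗ F.obj n.unop) ⊗ constSimplex.obj m.unop ⟶ X := (ψ.app n).app m z.2
            exact congr($((φ.app n).naturality f) ((z.1, SSet.stdSimplex.objEquiv.symm (𝟙 n.unop)),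
              SSet.stdSimplex.objEquiv.symm (𝟙 m.unop))) }
      naturality n n' f := by
        ext m z
        change evalAt ((ψ.app (op n'.unop)).app m ((K.map f.unop.op).app m z.2)) _ (𝟙 _) (𝟙 _) =
          (X.map f).app m _
        rw [expo_app_map_left ψ f.unop z.2]
        exact congr(($((((ψ.app n).app m z.2 :
          (A ⊗ F.obj n.unop) ⊗ constSimplex.obj m.unop ⟶ X)).naturality f)).app m
          ((z.1, SSet.stdSimplex.objEquiv.symm (𝟙 _)), SSet.stdSimplex.objEquiv.symm (𝟙 _))) }
  left_inv φ := by
    refine hom_ext fun n m z ↦ ?_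
    exact congr((φ.app (op n)).app (op m) (z.1, $(cell_app_id z.2)))
  right_inv ψ := by
    ext n m k
    refine hom_ext fun n' m' z ↦ ?_
    change evalAt ((ψ.app (op n')).app (op m')
      ((K.map (SSet.stdSimplex.objEquiv z.1.2).op).app (op m')
        ((K.obj n).map (SSet.stdSimplex.objEquiv z.2).op k))) z.1.1 (𝟙 _) (𝟙 _) = _
    rw [expo_app_map_left ψ, expo_app_map_right ψ]
    obtain ⟨⟨a, s⟩, t⟩ := z
    obtain ⟨s, rfl⟩ := SSet.stdSimplex.objEquiv.symm.surjective s
    obtain ⟨t, rfl⟩ := SSet.stdSimplex.objEquiv.symm.surjective t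
    change evalAt _ a (𝟙 n' ≫ s) (𝟙 m' ≫ t) = evalAt _ a s t
    rw [Category.id_comp, Category.id_comp]
    rfl

/-- The internal hom of bisimplicial sets, as a functor. -/
@[simps]
def expoFunctor (A : BiSSet.{u}) : BiSSet.{u} ⥤ BiSSet.{u} where
  obj := expo A
  map := expo.post A

/-- `A ⊗ -` is left adjoint to the internal hom. -/
def tensorExpoAdj (A : BiSSet.{u}) : tensorLeft A ⊣ expoFunctor A :=
  Adjunction.mkOfHomEquiv
    { homEquiv K X := expoHomEquiv A K X
      homEquiv_naturality_left_symm f g := rfl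
      homEquiv_naturality_right f g := by
        ext n m k
        change _ ≫ A ◁ cell _ ≫ f ≫ g = (_ ≫ A ◁ cell _ ≫ f) ≫ g
        simp }

/-- With the explicit internal hom as the closed structure, pushout-products of arrows become left
adjoint to pullback-homs, and the general lifting calculus applies. -/
instance : MonoidalClosed BiSSet.{u} where
  closed A := { rightAdj := expoFunctor A, adj := tensorExpoAdj A }

/-! ### The mapping space as a right adjoint -/

lemma map_app_map {A X : BiSSet.{u}} {K : SSet.{u}} (ψ : K ⟶ Map A X) {m m' : SimplexCategory}
    (f : m' ⟶ m) (k : K.obj (op m)) :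
    ψ.app (op m') (K.map f.op k) = (A ◁ constSimplex.map f ≫ ψ.app (op m) k :) :=
  NatTrans.naturality_apply ψ f.op k

/-- Currying for the mapping space of bisimplicial sets. -/
def mapHomEquiv (A : BiSSet.{u}) (K : SSet.{u}) (X : BiSSet.{u}) :
    (A ⊗ constant.obj K ⟶ X) ≃ (K ⟶ Map A X) where
  toFun φ :=
    { app m := ↾fun k ↦ A ◁ constant.map ((SSet.yonedaEquiv (n := m.unop)).symm k) ≫ φ
      naturality m m' f := by
        ext k
        change A ◁ constant.map ((SSet.yonedaEquiv (n := m'.unop)).symm (K.map f.unop.op k)) ≫ φ =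
          A ◁ constant.map (SSet.stdSimplex.map f.unop) ≫ A ◁ _ ≫ φ
        rw [← whiskerLeft_comp_assoc, ← Functor.map_comp, SSet.yonedaEquiv_symm_naturality_left] }
  invFun ψ :=
    { app n :=
        { app m := ↾fun z ↦ ((ψ.app m z.2 : A ⊗ constSimplex.obj m.unop ⟶ X).app n).app m
            (z.1, SSet.stdSimplex.objEquiv.symm (𝟙 _))
          naturality m m' f := by
            ext z
            change ((ψ.app (op m'.unop) (K.map f.unop.op z.2) :
              A ⊗ constSimplex.obj m'.unop ⟶ X).app n).app m' _ = (X.obj n).map f _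
            rw [map_app_map]
            let φ : A ⊗ constSimplex.obj m.unop ⟶ X := ψ.app m z.2
            exact congr($((φ.app n).naturality f) (z.1, SSet.stdSimplex.objEquiv.symm (𝟙 m.unop))) }
      naturality n n' f := by
        ext m z
        exact congr(($((ψ.app m z.2 :
          A ⊗ constSimplex.obj m.unop ⟶ X).naturality f)).app m
          (z.1, SSet.stdSimplex.objEquiv.symm (𝟙 _))) }
  left_inv φ := by
    refine hom_ext fun n m z ↦ ?_
    have : (SSet.yonedaEquiv.symm z.2).app (op m) (SSet.stdSimplex.objEquiv.symm (𝟙 m)) = z.2 :=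
      SSet.yonedaEquiv.apply_symm_apply z.2
    exact congr((φ.app (op n)).app (op m) (z.1, $this))
  right_inv ψ := by
    ext m k
    refine hom_ext fun n' m' z ↦ ?_
    change ((ψ.app (op m') (K.map (SSet.stdSimplex.objEquiv z.2).op k) :
      A ⊗ constSimplex.obj m' ⟶ X).app _).app _ (z.1, SSet.stdSimplex.objEquiv.symm (𝟙 _)) = _
    rw [map_app_map]
    obtain ⟨a, t⟩ := z
    obtain ⟨t, rfl⟩ := SSet.stdSimplex.objEquiv.symm.surjective t
    change ((ψ.app m k : A ⊗ constSimplex.obj m.unop ⟶ X).app _).app _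
      (a, SSet.stdSimplex.objEquiv.symm (𝟙 m' ≫ t)) = _
    rw [Category.id_comp]
    rfl

/-- The mapping space, as a bifunctor. -/
@[simps]
def mapFunctor : BiSSet.{u}ᵒᵖ ⥤ BiSSet.{u} ⥤ SSet.{u} where
  obj A := { obj := Map A.unop, map := Map.post A.unop }
  map i := { app := Map.pre i.unop }

/-- The functor `(A, K) ↦ A ⊗ K`, where `K` is regarded as a constant simplicial space. -/
@[simps!]
def tensorConstant : BiSSet.{u} ⥤ SSet.{u} ⥤ BiSSet.{u} :=
  curriedTensor _ ⋙ (Functor.whiskeringLeft _ _ _).obj constant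

/-- The mapping space is right adjoint to the tensor product with constant simplicial spaces. -/
def tensorConstantMapAdj : tensorConstant.{u} ⊣₂ mapFunctor.{u} :=
  .mk' (fun A ↦ Adjunction.mkOfHomEquiv
    { homEquiv K X := mapHomEquiv A K X
      homEquiv_naturality_left_symm f g := rfl
      homEquiv_naturality_right f g := by
        ext m k
        exact (Category.assoc _ _ _).symm }) (fun {A A'} i K X g ↦ by
    ext m k
    exact whisker_exchange_assoc i (constant.map _) g)

/-! ### Lifting properties and pushout-products -/

/-- The pushout-product of two morphisms. -/
abbrev leibniz {A A' K K' : BiSSet.{u}} (i : A ⟶ A') (j : K ⟶ K') :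
    pushout (i ▷ K) (A ◁ j) ⟶ A' ⊗ K' :=
  (Functor.PushoutObjObj.ofHasPushout (curriedTensor BiSSet.{u}) i j).ι

/-- Two models of the pushout-product have the same lifting properties. -/
lemma hasLiftingProperty_leibniz_iff {A A' K K' X Y : BiSSet.{u}} {i : A ⟶ A'} {j : K ⟶ K'}
    (sq : (curriedTensor BiSSet.{u}).PushoutObjObj i j) (f : X ⟶ Y) :
    HasLiftingProperty (leibniz i j) f ↔ HasLiftingProperty sq.ι f := by
  let sq' := Functor.PushoutObjObj.ofHasPushout (curriedTensor BiSSet.{u}) i j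
  refine HasLiftingProperty.iff_of_arrow_iso_left (Arrow.isoMk
    (sq'.isPushout.isoIsPushout _ _ sq.isPushout) (Iso.refl _) ?_) f
  apply sq'.isPushout.hom_ext
  · exact (sq'.isPushout.inl_isoIsPushout_hom_assoc _ _ sq.isPushout sq.ι).trans
      (sq.inl_ι.trans (sq'.inl_ι.symm.trans (by simp [sq'])))
  · exact (sq'.isPushout.inr_isoIsPushout_hom_assoc _ _ sq.isPushout sq.ι).trans
      (sq.inr_ι.trans (sq'.inr_ι.symm.trans (by simp [sq'])))

/-- The image of a pushout-product under `discrete`. -/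
def discretePushoutObjObj {K K' L L' : SSet.{u}} {i : K ⟶ K'} {j : L ⟶ L'}
    (sq : (curriedTensor SSet.{u}).PushoutObjObj i j) :
    (curriedTensor BiSSet.{u}).PushoutObjObj (discrete.map i) (discrete.map j) where
  pt := discrete.obj sq.pt
  inl := discrete.map sq.inl
  inr := discrete.map sq.inr
  isPushout := sq.isPushout.map discrete
  ι := discrete.map sq.ι
  inl_ι := (discrete.map_comp _ _).symm.trans (congr(discrete.map $(sq.inl_ι)))
  inr_ι := (discrete.map_comp _ _).symm.trans (congr(discrete.map $(sq.inr_ι)))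

/-- The image of a pushout-product under `constant`. -/
def constantPushoutObjObj {K K' L L' : SSet.{u}} {i : K ⟶ K'} {j : L ⟶ L'}
    (sq : (curriedTensor SSet.{u}).PushoutObjObj i j) :
    (curriedTensor BiSSet.{u}).PushoutObjObj (constant.map i) (constant.map j) where
  pt := constant.obj sq.pt
  inl := constant.map sq.inl
  inr := constant.map sq.inr
  isPushout := sq.isPushout.map constant
  ι := constant.map sq.ι
  inl_ι := (constant.map_comp _ _).symm.trans (congr(constant.map $(sq.inl_ι)))
  inr_ι := (constant.map_comp _ _).symm.trans (congr(constant.map $(sq.inr_ι)))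

lemma hasLiftingProperty_leibniz_comm {A A' K K' X Y : BiSSet.{u}} (i : A ⟶ A') (j : K ⟶ K')
    (f : X ⟶ Y) : HasLiftingProperty (leibniz i j) f ↔ HasLiftingProperty (leibniz j i) f :=
  HasLiftingProperty.iff_of_arrow_iso_left
    (Arrow.PushoutProduct.braiding (Arrow.mk i) (Arrow.mk j)) f

lemma hasLiftingProperty_leibniz_assoc {A A' K K' L L' X Y : BiSSet.{u}} (i : A ⟶ A')
    (j : K ⟶ K') (k : L ⟶ L') (f : X ⟶ Y) :
    HasLiftingProperty (leibniz (leibniz i j) k) f ↔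
      HasLiftingProperty (leibniz i (leibniz j k)) f :=
  HasLiftingProperty.iff_of_arrow_iso_left
    (Arrow.PushoutProduct.associator (Arrow.mk i) (Arrow.mk j) (Arrow.mk k)) f

/-- The pullback-hom of two morphisms. -/
abbrev expoHom {A A' X Y : BiSSet.{u}} (i : A ⟶ A') (f : X ⟶ Y) :=
  ((Arrow.pullbackHom.obj (op (Arrow.mk i))).obj (Arrow.mk f)).hom

lemma hasLiftingProperty_expoHom_iff {A A' K K' X Y : BiSSet.{u}} (i : A ⟶ A') (j : K ⟶ K')
    (f : X ⟶ Y) : HasLiftingProperty (leibniz i j) f ↔ HasLiftingProperty j (expoHom i f) :=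
  Arrow.PushoutProduct.hasLiftingProperty_mk_iff

lemma hasLiftingProperty_expoHom_iff' {A A' K K' X Y : BiSSet.{u}} (i : A ⟶ A') (j : K ⟶ K')
    (f : X ⟶ Y) : HasLiftingProperty (leibniz i j) f ↔ HasLiftingProperty i (expoHom j f) :=
  (hasLiftingProperty_leibniz_comm _ _ _).trans (hasLiftingProperty_expoHom_iff _ _ _)

lemma hasLiftingProperty_expo_post_iff {A K K' X Y : BiSSet.{u}} (j : K ⟶ K') (f : X ⟶ Y) :
    HasLiftingProperty (A ◁ j) f ↔ HasLiftingProperty j (expo.post A f) :=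
  (tensorExpoAdj A).hasLiftingProperty_iff j f

/-- The relative matching map. -/
abbrev mapHom {A A' X Y : BiSSet.{u}} (i : A ⟶ A') (f : X ⟶ Y) :
    Map A' X ⟶ pullback (Map.pre i Y) (Map.post A f) :=
  pullback.lift (Map.post A' f) (Map.pre i X) rfl

lemma hasLiftingProperty_mapHom_iff {A A' X Y : BiSSet.{u}} {K L : SSet.{u}} (i : A ⟶ A')
    (j : K ⟶ L) (f : X ⟶ Y) :
    HasLiftingProperty (leibniz i (constant.map j)) f ↔ HasLiftingProperty j (mapHom i f) := by
  let sq : tensorConstant.PushoutObjObj i j :=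
    { pt := _
      inl := pushout.inl (i ▷ _) (A ◁ constant.map j)
      inr := pushout.inr _ _
      isPushout := IsPushout.of_hasPushout _ _
      ι := leibniz i (constant.map j)
      inl_ι := (Functor.PushoutObjObj.ofHasPushout (curriedTensor BiSSet.{u}) i _).inl_ι
      inr_ι := (Functor.PushoutObjObj.ofHasPushout (curriedTensor BiSSet.{u}) i _).inr_ι }
  let sq' : mapFunctor.PullbackObjObj i f :=
    { pt := _
      fst := pullback.snd (Map.pre i Y) (Map.post A f)
      snd := pullback.fst _ _
      isPullback := (IsPullback.of_hasPullback _ _).flip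
      π := mapHom i f
      π_fst := pullback.lift_snd _ _ _
      π_snd := pullback.lift_fst _ _ _ }
  exact ParametrizedAdjunction.hasLiftingProperty_iff tensorConstantMapAdj sq sq'

lemma hasLiftingProperty_map_post_iff {A X Y : BiSSet.{u}} {K L : SSet.{u}} (j : K ⟶ L)
    (f : X ⟶ Y) :
    HasLiftingProperty (A ◁ constant.map j) f ↔ HasLiftingProperty j (Map.post A f) :=
  (tensorConstantMapAdj.adj A).hasLiftingProperty_iff j f

/-- Maps into the point form a point. -/
def isTerminalMapUnit (A : BiSSet.{u}) {Y : BiSSet.{u}} (hY : IsTerminal Y) :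
    IsTerminal (Map A Y) :=
  .ofUniqueHom (fun K ↦ { app m := ↾fun _ ↦ hY.from _
                          naturality _ _ _ := by
                            ext
                            exact hY.hom_ext _ _ })
    (fun K f ↦ by
      ext
      exact hY.hom_ext _ _)

lemma hasLiftingProperty_map_pre_iff {A A' X Y : BiSSet.{u}} {K L : SSet.{u}} (i : A ⟶ A')
    (j : K ⟶ L) (hY : IsTerminal Y) (f : X ⟶ Y) :
    HasLiftingProperty (leibniz i (constant.map j)) f ↔ HasLiftingProperty j (Map.pre i X) := by
  rw [hasLiftingProperty_mapHom_iff]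
  have : IsIso (Map.pre i Y) := ⟨(isTerminalMapUnit A' hY).from _,
    (isTerminalMapUnit A' hY).hom_ext _ _, (isTerminalMapUnit A hY).hom_ext _ _⟩
  exact HasLiftingProperty.iff_of_arrow_iso_right j
    (Arrow.isoMk (Iso.refl _) (asIso (pullback.snd (Map.pre i Y) (Map.post A f)))
      ((Category.id_comp _).trans (pullback.lift_snd _ _ _).symm))

/-! ### Reedy fibrations and lifting properties -/

lemma fibration_iff_hasLiftingProperty {E B : SSet.{u}} (p : E ⟶ B) :
    Fibration p ↔ ∀ ⦃K L : SSet.{u}⦄ (j : K ⟶ L), SSet.anodyneExtensions j →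
      HasLiftingProperty j p :=
  ⟨fun _ _ _ _ hj ↦ hj.hasLiftingProperty p, fun h ↦ by
    rw [SSet.modelCategoryQuillen.fibration_iff]
    intro K L j hj
    refine h j ?_
    intro _ _ q hq
    have := (HomotopicalAlgebra.fibration_iff q).2 hq
    rw [SSet.modelCategoryQuillen.fibration_iff] at this
    exact this _ hj⟩

/-- Allowing all anodyne maps, and not only horn inclusions, keeps the class of test maps stable
under pushout-products with monomorphisms. -/
lemma isReedyFibration_iff {X Y : BiSSet.{u}} (f : X ⟶ Y) :
    IsReedyFibration f ↔ ∀ (n : ℕ) ⦃K L : SSet.{u}⦄ (j : K ⟶ L), SSet.anodyneExtensions j →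
      HasLiftingProperty (leibniz (boundaryIncl n) (constant.map j)) f := by
  simp only [hasLiftingProperty_mapHom_iff]
  exact forall_congr' fun n ↦ fibration_iff_hasLiftingProperty _

/-! ### A criterion for the left lifting property -/

/-- The action of a pair of simplicial operators. -/
def act {Z : BiSSet.{u}} {n m n' m' : SimplexCategory} (s : n' ⟶ n) (t : m' ⟶ m)
    (z : (Z.obj (op n)).obj (op m)) : (Z.obj (op n')).obj (op m') :=
  (Z.map s.op).app (op m') ((Z.obj (op n)).map t.op z)

lemma act_act {Z : BiSSet.{u}} {n m n' m' n'' m'' : SimplexCategory} (s : n' ⟶ n) (t : m' ⟶ m)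
    (s' : n'' ⟶ n') (t' : m'' ⟶ m') (z : (Z.obj (op n)).obj (op m)) :
    act s' t' (act s t z) = act (s' ≫ s) (t' ≫ t) z := by
  dsimp only [act]
  rw [← NatTrans.naturality_apply, op_comp, op_comp, Functor.map_comp, Functor.map_comp_apply]
  rfl

lemma act_id {Z : BiSSet.{u}} {n m : SimplexCategory} (z : (Z.obj (op n)).obj (op m)) :
    act (𝟙 n) (𝟙 m) z = z :=
  cell_app_id z

lemma app_act {Z W : BiSSet.{u}} (f : Z ⟶ W) {n m n' m' : SimplexCategory} (s : n' ⟶ n)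
    (t : m' ⟶ m) (z : (Z.obj (op n)).obj (op m)) :
    (f.app (op n')).app (op m') (act s t z) = act s t ((f.app (op n)).app (op m) z) := by
  have h₁ := congr(($(f.naturality s.op)).app (op m') ((Z.obj (op n)).map t.op z))
  have h₂ := NatTrans.naturality_apply (f.app (op n)) t.op z
  exact h₁.trans congr((W.map s.op).app (op m') $h₂)

lemma exists_factor_of_not_surjective {n p : SimplexCategory} (s : n ⟶ p)
    (hs : ¬ Function.Surjective s.toOrderHom) :
    ∃ (r : SimplexCategory) (θ : n ⟶ r) (ι : r ⟶ p), r.len < p.len ∧ θ ≫ ι = s := by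
  obtain ⟨n⟩ := n
  obtain ⟨p⟩ := p
  obtain _ | p := p
  · exact absurd (fun x ↦ ⟨0, Subsingleton.elim (α := Fin 1) _ _⟩) hs
  · obtain ⟨i, θ, rfl⟩ := SimplexCategory.eq_comp_δ_of_not_surjective s hs
    exact ⟨_, θ, SimplexCategory.δ i, Nat.lt_succ_self p, rfl⟩

/-- A surjective simplicial operator is determined by its sections. -/
lemma eq_of_forall_section {n p : SimplexCategory} (s s' : n ⟶ p)
    (hs : Function.Surjective s.toOrderHom) (h : ∀ e : p ⟶ n, e ≫ s = 𝟙 p → e ≫ s' = 𝟙 p) :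
    s = s' := by
  classical
  ext a : 3
  choose e he using hs
  -- Any set-theoretic section of a monotone surjection is monotone, so there is a section whose
  -- image contains the prescribed `a`; it detects the value of `s'` at `a`.
  let e' (j) := if j = s.toOrderHom a then a else e j
  have he' (j) : s.toOrderHom (e' j) = j := by
    by_cases hj : j = s.toOrderHom a
    · simp [e', hj]
    · simp [e', hj, he]
  have hmono : Monotone e' := fun i j hij ↦ by
    by_contra! hlt
    have := s.toOrderHom.monotone hlt.le
    rw [he', he'] at this
    obtain rfl := le_antisymm hij this
    exact lt_irrefl _ hlt
  have := h (SimplexCategory.Hom.mk ⟨e', hmono⟩) (by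
    ext j : 3
    exact he' j)
  have := congr(($this).toOrderHom (s.toOrderHom a))
  have h₂ : e' (s.toOrderHom a) = a := if_pos rfl
  change s'.toOrderHom (e' (s.toOrderHom a)) = s.toOrderHom a at this
  rw [h₂] at this
  exact this.symm

lemma exists_section {n p : SimplexCategory} (s : n ⟶ p)
    (hs : Function.Surjective s.toOrderHom) : ∃ e : p ⟶ n, e ≫ s = 𝟙 p := by
  choose e he using hs
  refine ⟨SimplexCategory.Hom.mk ⟨e, fun i j hij ↦ ?_⟩, by
    ext j : 3
    exact he j⟩
  by_contra! hlt
  have := s.toOrderHom.monotone hlt.le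
  rw [he, he] at this
  obtain rfl := le_antisymm hij this
  exact lt_irrefl _ hlt

/-- A partial solution of a lifting problem, as the graph of a function. -/
structure IsPartialLift {A A' X Y : BiSSet.{u}} (i : A ⟶ A') (f : X ⟶ Y) (a : A ⟶ X) (b : A' ⟶ Y)
    (Γ : ∀ n m : SimplexCategory, (A'.obj (op n)).obj (op m) → (X.obj (op n)).obj (op m) → Prop) :
    Prop where
  unique {n m z x x'} : Γ n m z x → Γ n m z x' → x = x'
  act {n m n' m' z x} (s : n' ⟶ n) (t : m' ⟶ m) : Γ n m z x → Γ n' m' (act s t z) (act s t x)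
  left {n m} (z : (A.obj (op n)).obj (op m)) :
    Γ n m ((i.app (op n)).app (op m) z) ((a.app (op n)).app (op m) z)
  right {n m z x} : Γ n m z x → (f.app (op n)).app (op m) x = (b.app (op n)).app (op m) z

namespace IsPartialLift

variable {A A' X Y : BiSSet.{u}} {i : A ⟶ A'} {f : X ⟶ Y} {a : A ⟶ X} {b : A' ⟶ Y}

lemma exists_map
    {Γ : ∀ n m : SimplexCategory, (A'.obj (op n)).obj (op m) → (X.obj (op n)).obj (op m) → Prop}
    (h : IsPartialLift i f a b Γ) {K : BiSSet.{u}} (c : K ⟶ A')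
    (h' : ∀ n m k, ∃ x, Γ n m ((c.app (op n)).app (op m) k) x) :
    ∃ l : K ⟶ X, ∀ n m k, Γ n m ((c.app (op n)).app (op m) k) ((l.app (op n)).app (op m) k) := by
  choose l hl using h'
  have hact {n m n' m' : SimplexCategory} (s : n' ⟶ n) (t : m' ⟶ m) (k) :
      l n' m' (BiSSet.act s t k) = BiSSet.act s t (l n m k) := by
    have := hl _ _ (BiSSet.act s t k)
    rw [app_act] at this
    exact h.unique this (h.act s t (hl _ _ _))
  exact ⟨
    { app n :=
        { app m := ↾fun z ↦ l n.unop m.unop z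
          naturality m m' t := by
            ext z
            have := hact (𝟙 n.unop) t.unop z
            dsimp only [BiSSet.act] at this
            rw [op_id, CategoryTheory.Functor.map_id, CategoryTheory.Functor.map_id] at this
            exact this }
      naturality n n' s := by
        ext m z
        have := hact s.unop (𝟙 m.unop) z
        dsimp only [BiSSet.act] at this
        rw [op_id, Functor.map_id_apply, Functor.map_id_apply] at this
        exact this }, fun n m k ↦ hl n m k⟩

/-- A partial solution that is everywhere defined is a solution. -/
lemma hasLift
    {Γ : ∀ n m : SimplexCategory, (A'.obj (op n)).obj (op m) → (X.obj (op n)).obj (op m) → Prop}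
    (h : IsPartialLift i f a b Γ) (h' : ∀ n m z, ∃ x, Γ n m z x) (sq : CommSq a i f b) :
    sq.HasLift := by
  obtain ⟨l, hl⟩ := h.exists_map (𝟙 A') h'
  refine ⟨⟨{ l := l, fac_left := ?_, fac_right := ?_ }⟩⟩
  · ext n m z
    exact h.unique (hl _ _ _) (h.left (n := n.unop) (m := m.unop) z)
  · ext n m z
    exact h.right (hl n.unop m.unop z)

/-- Zorn's lemma, starting from the graph of `a` on the image of `i`; injectivity of `i` makes this
graph functional. For graphs the union of a chain is a plain disjunction. -/
lemma exists_maximal [Mono i] (sq : CommSq a i f b) :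
    ∃ Γ, IsPartialLift i f a b Γ ∧ ∀ Γ', IsPartialLift i f a b Γ' → Γ ≤ Γ' → Γ' ≤ Γ := by
  have hi {n m : SimplexCategory} : Function.Injective ((i.app (op n)).app (op m)) := by
    have : Mono ((i.app (op n)).app (op m)) := inferInstance
    exact (mono_iff_injective _).1 this
  obtain ⟨Γ, -, h⟩ := zorn_le_nonempty₀ {Γ | IsPartialLift i f a b Γ} (fun c hc hc' Γ₀ hΓ₀ ↦ by
    refine ⟨fun n m z x ↦ ∃ Γ ∈ c, Γ n m z x, ⟨?_, ?_, ?_, ?_⟩, ?_⟩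
    · rintro n m z x x' ⟨Γ, hΓ, h⟩ ⟨Γ', hΓ', h'⟩
      obtain hle | hle := hc'.total hΓ hΓ'
      · exact (hc hΓ').unique (hle _ _ _ _ h) h'
      · exact (hc hΓ).unique h (hle _ _ _ _ h')
    · rintro n m n' m' z x s t ⟨Γ, hΓ, h⟩
      exact ⟨Γ, hΓ, (hc hΓ).act s t h⟩
    · intro n m z
      exact ⟨Γ₀, hΓ₀, (hc hΓ₀).left z⟩
    · rintro n m z x ⟨Γ, hΓ, h⟩
      exact (hc hΓ).right h
    · intro Γ hΓ n m z x h
      exact ⟨Γ, hΓ, h⟩) (fun n m z x ↦ ∃ w, (i.app (op n)).app (op m) w = z ∧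
        (a.app (op n)).app (op m) w = x) (by
    refine ⟨?_, ?_, ?_, ?_⟩
    · rintro n m z x x' ⟨w, rfl, rfl⟩ ⟨w', h, rfl⟩
      rw [hi h]
    · rintro n m n' m' z x s t ⟨w, rfl, rfl⟩
      exact ⟨BiSSet.act s t w, app_act _ _ _ _, app_act _ _ _ _⟩
    · intro n m z
      exact ⟨z, rfl, rfl⟩
    · rintro n m z x ⟨w, rfl, rfl⟩
      exact congr((($sq.w).app (op n)).app (op m) w))
  exact ⟨Γ, h.prop, fun Γ' h' hle ↦ h.le_of_ge h' hle⟩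

/-- A partial solution extends to an element all of whose faces belong to its domain. -/
lemma exists_extension
    {Γ : ∀ n m : SimplexCategory, (A'.obj (op n)).obj (op m) → (X.obj (op n)).obj (op m) → Prop}
    (hΓ : IsPartialLift i f a b Γ) {p q : ℕ} (z : (A'.obj (op ⦋p⦌)).obj (op ⦋q⦌))
    (hz : ∀ x, ¬ Γ _ _ z x)
    (hf : HasLiftingProperty (leibniz (boundaryIncl p) (constant.map ∂Δ[q].ι)) f)
    (hmin : ∀ {n m : SimplexCategory} (s : n ⟶ ⦋p⦌) (t : m ⟶ ⦋q⦌),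
      ¬ (Function.Surjective s.toOrderHom ∧ Function.Surjective t.toOrderHom) →
        ∃ x, Γ n m (BiSSet.act s t z) x) :
    ∃ Γ', IsPartialLift i f a b Γ' ∧ Γ ≤ Γ' ∧ ∃ x, Γ' _ _ z x := by
  -- `u` and `v` are the values already prescribed on `F(p) × ∂Δ[q]` and `∂F(p) × Δ[q]`; the lift
  -- `H` extends them to the whole bisimplex.
  obtain ⟨u, hu⟩ := hΓ.exists_map (F.obj ⦋p⦌ ◁ constant.map ∂Δ[q].ι ≫ cell z)
    (fun n m k ↦ hmin (SSet.stdSimplex.objEquiv k.1) (SSet.stdSimplex.objEquiv k.2.1)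
      fun h ↦ k.2.2 h.2)
  obtain ⟨v, hv⟩ := hΓ.exists_map (boundaryIncl p ▷ constSimplex.obj ⦋q⦌ ≫ cell z)
    (fun n m k ↦ hmin (SSet.stdSimplex.objEquiv k.1.1) (SSet.stdSimplex.objEquiv k.2)
      fun h ↦ k.1.2 h.1)
  obtain ⟨H, hHu, hHv, hHb⟩ := exists_lift_of_pushoutObjObj _ hf u v (cell z ≫ b)
    (by
      refine hom_ext fun n m k ↦ ?_
      exact hΓ.unique (hu n m (⟨k.1.1, k.2⟩ : (Δ[p] : SSet.{u}).obj _ × (∂Δ[q] : SSet.{u}).obj _))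
        (hv n m (⟨k.1, k.2.1⟩ : (∂Δ[p] : SSet.{u}).obj _ × (Δ[q] : SSet.{u}).obj _)))
    (by
      refine hom_ext fun n m k ↦ ?_
      exact (hΓ.right (hu n m k)).symm)
    (by
      refine hom_ext fun n m k ↦ ?_
      exact (hΓ.right (hv n m k)).symm)
  let val {n m : SimplexCategory} (s : n ⟶ ⦋p⦌) (t : m ⟶ ⦋q⦌) : (X.obj (op n)).obj (op m) :=
    (H.app (op n)).app (op m) (SSet.stdSimplex.objEquiv.symm s, SSet.stdSimplex.objEquiv.symm t)
  have hval {n m : SimplexCategory} (s : n ⟶ ⦋p⦌) (t : m ⟶ ⦋q⦌)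
      (h : ¬ (Function.Surjective s.toOrderHom ∧ Function.Surjective t.toOrderHom)) :
      Γ n m (BiSSet.act s t z) (val s t) := by
    by_cases hs : Function.Surjective s.toOrderHom
    · have ht : ¬ Function.Surjective t.toOrderHom := fun ht ↦ h ⟨hs, ht⟩
      have := hu n m (SSet.stdSimplex.objEquiv.symm s, ⟨SSet.stdSimplex.objEquiv.symm t, ht⟩)
      rw [← hHu] at this
      exact this
    · have := hv n m (⟨SSet.stdSimplex.objEquiv.symm s, hs⟩, SSet.stdSimplex.objEquiv.symm t)
      rw [← hHv] at this
      exact this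
  -- If both operators were surjective, sections of them would recover `z` from its degeneracy and
  -- put `z` into the domain.
  have hdom {n m : SimplexCategory} (s : n ⟶ ⦋p⦌) (t : m ⟶ ⦋q⦌) {x}
      (h : Γ n m (BiSSet.act s t z) x) :
      ¬ (Function.Surjective s.toOrderHom ∧ Function.Surjective t.toOrderHom) := by
    rintro ⟨hs, ht⟩
    obtain ⟨e, he⟩ := exists_section s hs
    obtain ⟨g, hg⟩ := exists_section t ht
    have := hΓ.act e g h
    rw [act_act, he, hg, act_id] at this
    exact hz _ this
  have hval' {n m n' m' : SimplexCategory} (s : n ⟶ ⦋p⦌) (t : m ⟶ ⦋q⦌) (s' : n' ⟶ n)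
      (t' : m' ⟶ m) : BiSSet.act s' t' (val s t) = val (s' ≫ s) (t' ≫ t) :=
    (app_act H s' t' _).symm
  have hΓval {n m : SimplexCategory} (s : n ⟶ ⦋p⦌) (t : m ⟶ ⦋q⦌) {x}
      (h : Γ n m (BiSSet.act s t z) x) : x = val s t :=
    hΓ.unique h (hval s t (hdom s t h))
  -- The uniqueness part of the Eilenberg–Zilber lemma: `z` is fixed by `(e ≫ s', g ≫ t')`, and no
  -- proper face operator can fix it because proper faces are in the domain. So both are surjective
  -- endomorphisms, hence identities.
  have hsurj {n m : SimplexCategory} {s s' : n ⟶ ⦋p⦌} {t t' : m ⟶ ⦋q⦌}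
      (hs : Function.Surjective s.toOrderHom) (ht : Function.Surjective t.toOrderHom)
      (h : BiSSet.act s t z = BiSSet.act s' t' z) (e : ⦋p⦌ ⟶ n) (g : ⦋q⦌ ⟶ m)
      (he : e ≫ s = 𝟙 _) (hg : g ≫ t = 𝟙 _) : e ≫ s' = 𝟙 _ ∧ g ≫ t' = 𝟙 _ := by
    have h₂ : BiSSet.act (e ≫ s') (g ≫ t') z = z := by
      rw [← act_act, ← h, act_act, he, hg, act_id]
    have h₃ : Function.Surjective (e ≫ s').toOrderHom ∧
        Function.Surjective (g ≫ t').toOrderHom := by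
      by_contra h₃
      have := hval _ _ h₃
      rw [h₂] at this
      exact hz _ this
    have := SimplexCategory.epi_iff_surjective.2 h₃.1
    have := SimplexCategory.epi_iff_surjective.2 h₃.2
    exact ⟨SimplexCategory.eq_id_of_epi _, SimplexCategory.eq_id_of_epi _⟩
  refine ⟨fun n m w x ↦ Γ n m w x ∨ ∃ (s : n ⟶ ⦋p⦌) (t : m ⟶ ⦋q⦌), BiSSet.act s t z = w ∧
    val s t = x, ⟨?_, ?_, ?_, ?_⟩, fun n m w x h ↦ Or.inl h,
    ⟨val (𝟙 _) (𝟙 _), Or.inr ⟨𝟙 _, 𝟙 _, act_id z, rfl⟩⟩⟩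
  · rintro n m w x x' (h | ⟨s, t, rfl, rfl⟩) (h' | ⟨s', t', h', rfl⟩)
    · exact hΓ.unique h h'
    · subst h'
      exact hΓval s' t' h
    · exact (hΓval s t h').symm
    · by_cases h₁ : Function.Surjective s.toOrderHom ∧ Function.Surjective t.toOrderHom
      · obtain ⟨e, he⟩ := exists_section s h₁.1
        obtain ⟨g, hg⟩ := exists_section t h₁.2
        rw [eq_of_forall_section s s' h₁.1 fun e he ↦ (hsurj h₁.1 h₁.2 h'.symm e g he hg).1,
          eq_of_forall_section t t' h₁.2 fun g hg ↦ (hsurj h₁.1 h₁.2 h'.symm e g he hg).2]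
      · have := hval s t h₁
        rw [← h'] at this
        exact hΓval s' t' this
  · rintro n m n' m' w x s' t' (h | ⟨s, t, rfl, rfl⟩)
    · exact Or.inl (hΓ.act _ _ h)
    · exact Or.inr ⟨s' ≫ s, t' ≫ t, (act_act _ _ _ _ _).symm, (hval' _ _ _ _).symm⟩
  · intro n m w
    exact Or.inl (hΓ.left w)
  · rintro n m w x (h | ⟨s, t, rfl, rfl⟩)
    · exact hΓ.right h
    · exact congr((($hHb).app (op n)).app (op m) (SSet.stdSimplex.objEquiv.symm s,
        SSet.stdSimplex.objEquiv.symm t))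

end IsPartialLift

/-- A monomorphism has the left lifting property against a map as soon as the boundary inclusions
of the bisimplices that it attaches do. -/
theorem hasLiftingProperty_of_mono {A A' X Y : BiSSet.{u}} (i : A ⟶ A') [Mono i] (f : X ⟶ Y)
    (D : ℕ → Prop) (hf : ∀ p q, D p →
      HasLiftingProperty (leibniz (boundaryIncl p) (constant.map ∂Δ[q].ι)) f)
    (hi : ∀ (p q : ℕ) (z : (A'.obj (op ⦋p⦌)).obj (op ⦋q⦌)), ¬ D p →
      (∃ w, (i.app _).app _ w = z) ∨
        ∃ (r : SimplexCategory) (s : ⦋p⦌ ⟶ r) (w : (A'.obj (op r)).obj (op ⦋q⦌)),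
          r.len < p ∧ act s (𝟙 _) w = z) :
    HasLiftingProperty i f := by
  refine ⟨fun {a b} sq ↦ ?_⟩
  obtain ⟨Γ, hΓ, hmax⟩ := IsPartialLift.exists_maximal sq
  refine hΓ.hasLift (fun n m z ↦ ?_) sq
  -- Induction on the total dimension: an element of least total dimension outside the domain of a
  -- maximal partial lift has all its proper faces in the domain.
  obtain ⟨k, hk⟩ : ∃ k, n.len + m.len = k := ⟨_, rfl⟩
  induction k using Nat.strong_induction_on generalizing n m with | _ k IH =>
  by_contra! hz
  obtain ⟨p⟩ := n
  obtain ⟨q⟩ := m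
  -- Elements of excluded dimension come from `A` or are degeneracies of elements of smaller total
  -- dimension, so they are in the domain already.
  have hD : D p := by
    by_contra hD
    obtain ⟨w, rfl⟩ | ⟨r, s, w, hr, rfl⟩ := hi p q z hD
    · exact hz _ (hΓ.left w)
    · obtain ⟨x, hx⟩ := IH (r.len + q) (by subst hk; exact Nat.add_lt_add_right hr q) r ⦋q⦌ w rfl
      exact hz _ (hΓ.act s (𝟙 _) hx)
  obtain ⟨Γ', hΓ', hle, x, hx⟩ := hΓ.exists_extension z hz (hf p q hD) (fun {n m} s t hst ↦ by
    by_cases hs : Function.Surjective s.toOrderHom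
    · obtain ⟨r, θ, ι, hr, rfl⟩ := exists_factor_of_not_surjective t fun ht ↦ hst ⟨hs, ht⟩
      obtain ⟨x, hx⟩ := IH (p + r.len) (by subst hk; exact Nat.add_lt_add_left hr p) ⦋p⦌ r
        (act (𝟙 _) ι z) rfl
      have := hΓ.act s θ hx
      rw [act_act, Category.comp_id] at this
      exact ⟨_, this⟩
    · obtain ⟨r, θ, ι, hr, rfl⟩ := exists_factor_of_not_surjective s hs
      obtain ⟨x, hx⟩ := IH (r.len + q) (by subst hk; exact Nat.add_lt_add_right hr q) r ⦋q⦌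
        (act ι (𝟙 _) z) rfl
      have := hΓ.act θ t hx
      rw [act_act, Category.comp_id] at this
      exact ⟨_, this⟩)
  exact hz x (hmax Γ' hΓ' hle _ _ _ _ hx)

/-! ### Mapping spaces and Reedy fibrations -/

lemma hasLiftingProperty_leibniz_constant_iff {A A' X Y : BiSSet.{u}} (i : A ⟶ A')
    {K K' L L' : SSet.{u}} {j : K ⟶ K'} {k : L ⟶ L'}
    (sq : (curriedTensor SSet.{u}).PushoutObjObj j k) (f : X ⟶ Y) :
    HasLiftingProperty (leibniz (leibniz i (constant.map j)) (constant.map k)) f ↔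
      HasLiftingProperty (leibniz i (constant.map sq.ι)) f := by
  rw [hasLiftingProperty_leibniz_assoc, hasLiftingProperty_expoHom_iff,
    hasLiftingProperty_leibniz_iff (constantPushoutObjObj sq)]
  exact (hasLiftingProperty_expoHom_iff _ _ _).symm

/-- The pullback-hom of a monomorphism and a Reedy fibration is a Kan fibration on mapping
spaces. -/
lemma IsReedyFibration.hasLiftingProperty {X Y : BiSSet.{u}} {f : X ⟶ Y}
    (hf : IsReedyFibration f) {A A' : BiSSet.{u}} (i : A ⟶ A') [Mono i] {K L : SSet.{u}}
    (j : K ⟶ L) (hj : SSet.anodyneExtensions j) :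
    HasLiftingProperty (leibniz i (constant.map j)) f := by
  -- Moving `j` to the right leaves a left lifting property of `i` itself, which can be checked on
  -- bisimplices. There `∂Δ[q] → Δ[q]` is absorbed into `j`, whose pushout-product with it is again
  -- anodyne.
  rw [hasLiftingProperty_expoHom_iff']
  refine hasLiftingProperty_of_mono i _ (fun _ ↦ True) (fun p q _ ↦ ?_)
    (fun _ _ _ h ↦ (h trivial).elim)
  refine (hasLiftingProperty_expoHom_iff' _ _ _).1
    ((hasLiftingProperty_leibniz_constant_iff (boundaryIncl p)
      (Functor.PushoutObjObj.ofHasPushout (curriedTensor SSet.{u}) ∂Δ[q].ι j) f).2 ?_)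
  exact (isReedyFibration_iff f).1 hf p _ (SSet.anodyneExtensions_pushoutObjObjι _ hj)

lemma hasLiftingProperty_initial_iff {A K K' X Y : BiSSet.{u}} {I : BiSSet.{u}} (hI : IsInitial I)
    (j : K ⟶ K') (f : X ⟶ Y) :
    HasLiftingProperty (leibniz (hI.to A) j) f ↔ HasLiftingProperty (A ◁ j) f :=
  HasLiftingProperty.iff_of_arrow_iso_left (Arrow.PushoutProduct.isInitialIso' (Arrow.mk j) hI) f

lemma hasLiftingProperty_whiskerLeft_leibniz_iff {A K K' L L' X Y : BiSSet.{u}}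
    (j : K ⟶ K') (k : L ⟶ L') (f : X ⟶ Y) :
    HasLiftingProperty (A ◁ leibniz j k) f ↔ HasLiftingProperty (leibniz (A ◁ j) k) f :=
  HasLiftingProperty.iff_of_arrow_iso_left
    (Arrow.PushoutProduct.whiskerLeftIso (Arrow.mk j) (Arrow.mk k)) f

instance mono_whiskerLeft (A : BiSSet.{u}) {K L : BiSSet.{u}} (i : K ⟶ L) [Mono i] :
    Mono (A ◁ i) where
  right_cancellation g h w := by
    refine CartesianMonoidalCategory.hom_ext _ _ ?_ ?_
    · simpa using congr($w ≫ fst _ _)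
    · rw [← cancel_mono i]
      simpa using congr($w ≫ snd _ _)

/-- By adjunction the test maps acquire a factor `A`, and `A × ∂F(n) → A × F(n)` is still a
monomorphism. -/
lemma IsReedyFibration.expo_post {X Y : BiSSet.{u}} {f : X ⟶ Y} (hf : IsReedyFibration f)
    (A : BiSSet.{u}) : IsReedyFibration (expo.post A f) := by
  rw [isReedyFibration_iff]
  intro n K L j hj
  rw [← hasLiftingProperty_expo_post_iff, hasLiftingProperty_whiskerLeft_leibniz_iff]
  exact hf.hasLiftingProperty _ j hj

lemma IsReedyFibration.fibration_map_post {X Y : BiSSet.{u}} {f : X ⟶ Y}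
    (hf : IsReedyFibration f) (A : BiSSet.{u}) : Fibration (Map.post A f) := by
  rw [fibration_iff_hasLiftingProperty]
  intro K L j hj
  refine (hasLiftingProperty_map_post_iff j f).1
    ((hasLiftingProperty_initial_iff (initialIsInitial (C := BiSSet.{u}))
      (constant.map j) f).1 ?_)
  exact hf.hasLiftingProperty _ j hj

lemma IsReedyFibration.fibration_mapHom {X Y : BiSSet.{u}} {f : X ⟶ Y}
    (hf : IsReedyFibration f) {A A' : BiSSet.{u}} (i : A ⟶ A') [Mono i] :
    Fibration (mapHom i f) := by
  rw [fibration_iff_hasLiftingProperty]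
  intro K L j hj
  rw [← hasLiftingProperty_mapHom_iff]
  exact hf.hasLiftingProperty _ j hj

/-- The unit of the monoidal structure is terminal. -/
abbrev isTerminalUnit : IsTerminal (𝟙_ BiSSet.{u}) := isTerminalTensorUnit

lemma IsReedyFibration.fibration_map_pre {X : BiSSet.{u}} (hX : IsReedyFibration (toUnit X))
    {A A' : BiSSet.{u}} (i : A ⟶ A') [Mono i] : Fibration (Map.pre i X) := by
  rw [fibration_iff_hasLiftingProperty]
  intro K L j hj
  rw [← hasLiftingProperty_map_pre_iff i j isTerminalUnit (toUnit X)]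
  exact hX.hasLiftingProperty _ j hj

lemma IsReedyFibration.kanComplex_map {X : BiSSet.{u}} (hX : IsReedyFibration (toUnit X))
    (A : BiSSet.{u}) : SSet.KanComplex (Map A X) := by
  have := hX.fibration_map_post A
  exact (isFibrant_iff_of_isTerminal (Map.post A (toUnit X))
    (isTerminalMapUnit A isTerminalUnit)).2 this

/-! ### Orthogonality -/

/-- The map `i` is (homotopically) left orthogonal to `f`. -/
def IsOrthogonal {A A' X Y : BiSSet.{u}} (i : A ⟶ A') (f : X ⟶ Y) : Prop :=
  ∀ m : ℕ, HasLiftingProperty (leibniz i (constant.map ∂Δ[m].ι)) f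

section

variable {A A' X Y : BiSSet.{u}}

lemma isOrthogonal_iff_mapHom {i : A ⟶ A'} {f : X ⟶ Y} :
    IsOrthogonal i f ↔ SSet.IsTrivialFibration (mapHom i f) := by
  simp only [IsOrthogonal, hasLiftingProperty_mapHom_iff]
  exact ⟨fun h _ _ _ ⟨m⟩ ↦ h m, fun h m ↦ h _ ⟨m⟩⟩

lemma isOrthogonal_iff_map_pre {i : A ⟶ A'} {f : X ⟶ Y} (hY : IsTerminal Y) :
    IsOrthogonal i f ↔ SSet.IsTrivialFibration (Map.pre i X) := by
  simp only [IsOrthogonal, hasLiftingProperty_map_pre_iff i _ hY f]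
  exact ⟨fun h _ _ _ ⟨m⟩ ↦ h m, fun h m ↦ h _ ⟨m⟩⟩

/-- Expresses orthogonality as an ordinary left lifting property of `i`, which gives closure under
composition, pushouts and retracts. -/
lemma isOrthogonal_iff_expoHom {i : A ⟶ A'} {f : X ⟶ Y} :
    IsOrthogonal i f ↔ ∀ m : ℕ, HasLiftingProperty i (expoHom (constant.map ∂Δ[m].ι) f) :=
  forall_congr' fun _ ↦ hasLiftingProperty_expoHom_iff' _ _ _

lemma IsOrthogonal.hasLiftingProperty {i : A ⟶ A'} {f : X ⟶ Y} (h : IsOrthogonal i f)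
    {K L : SSet.{u}} (j : K ⟶ L) [Mono j] : HasLiftingProperty (leibniz i (constant.map j)) f := by
  rw [hasLiftingProperty_mapHom_iff]
  exact (isOrthogonal_iff_mapHom.1 h).hasLiftingProperty j

lemma IsOrthogonal.comp {A'' : BiSSet.{u}} {i : A ⟶ A'} {j : A' ⟶ A''} {f : X ⟶ Y}
    (hi : IsOrthogonal i f) (hj : IsOrthogonal j f) : IsOrthogonal (i ≫ j) f := by
  rw [isOrthogonal_iff_expoHom] at hi hj ⊢
  intro m
  have := hi m
  have := hj m
  infer_instance

lemma IsOrthogonal.of_isPushout {K K' : BiSSet.{u}} {i : A ⟶ A'} {j : K ⟶ K'} {g : A ⟶ K}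
    {g' : A' ⟶ K'} {f : X ⟶ Y} (sq : IsPushout g i j g') (h : IsOrthogonal i f) :
    IsOrthogonal j f := by
  rw [isOrthogonal_iff_expoHom] at h ⊢
  intro m
  have := h m
  exact sq.hasLiftingProperty _

lemma IsOrthogonal.of_retract {K K' : BiSSet.{u}} {i : A ⟶ A'} {j : K ⟶ K'} {f : X ⟶ Y}
    (r : RetractArrow j i) (h : IsOrthogonal i f) : IsOrthogonal j f := by
  rw [isOrthogonal_iff_expoHom] at h ⊢
  intro m
  have := h m
  exact r.leftLiftingProperty _

lemma IsOrthogonal.of_arrow_iso {K K' : BiSSet.{u}} {i : A ⟶ A'} {j : K ⟶ K'} {f : X ⟶ Y}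
    (e : Arrow.mk j ≅ Arrow.mk i) (h : IsOrthogonal i f) : IsOrthogonal j f :=
  h.of_retract { i := e.hom, r := e.inv, retract := e.hom_inv_id }

lemma IsOrthogonal.of_isIso (i : A ⟶ A') [IsIso i] (f : X ⟶ Y) : IsOrthogonal i f := by
  rw [isOrthogonal_iff_expoHom]
  infer_instance

/-- Cancellation for trivial fibrations; Reedy fibrancy and `Mono j` make `Map.pre j X` a Kan
fibration. -/
lemma IsOrthogonal.of_comp {A'' : BiSSet.{u}} {i : A ⟶ A'} {j : A' ⟶ A''} [Mono j]
    (hX : IsReedyFibration (toUnit X)) (hi : IsOrthogonal i (toUnit X))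
    (hij : IsOrthogonal (i ≫ j) (toUnit X)) : IsOrthogonal j (toUnit X) := by
  rw [isOrthogonal_iff_map_pre isTerminalUnit] at hi hij ⊢
  have := hX.fibration_map_pre j
  refine SSet.IsTrivialFibration.of_comp _ _ hi ?_
  have : Map.pre j X ≫ Map.pre i X = Map.pre (i ≫ j) X := by
    ext m g
    exact (comp_whiskerRight_assoc i j (constSimplex.obj m.unop) g).symm
  rwa [this]

end

/-- Reedy fibrancy makes the Segal maps Kan fibrations between Kan complexes, where equivalences are
trivial fibrations. From here on the Segal condition is a lifting property. -/
lemma isSegalSpace_iff {X : BiSSet.{u}} : IsSegalSpace X ↔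
    IsReedyFibration (toUnit X) ∧ ∀ n, IsOrthogonal (spineIncl n) (toUnit X) := by
  simp only [isOrthogonal_iff_map_pre isTerminalUnit]
  refine ⟨fun h ↦ ⟨h.reedyFibrant, fun n ↦ ?_⟩, fun h ↦ ⟨h.1, fun n ↦ (h.2 n).isSpaceEquiv⟩⟩
  have := h.reedyFibrant.kanComplex_map
  have := h.reedyFibrant.fibration_map_pre (spineIncl n)
  exact SSet.isTrivialFibration_of_isSpaceEquiv _ (h.segal n)

section

open SSet

/-! ### Local monomorphisms of simplicial sets -/

/-- The map `K ⟶ L`, between discrete simplicial spaces, induces an equivalence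
`Map(L, X) ⟶ Map(K, X)`. -/
abbrev IsLocal (X : BiSSet.{u}) {K L : SSet.{u}} (i : K ⟶ L) : Prop :=
  IsOrthogonal (discrete.map i) (toUnit X)

namespace IsLocal

variable {X : BiSSet.{u}}

lemma comp {K L M : SSet.{u}} {i : K ⟶ L} {j : L ⟶ M} (hi : IsLocal X i) (hj : IsLocal X j) :
    IsLocal X (i ≫ j) := by
  rw [IsLocal, Functor.map_comp]
  exact IsOrthogonal.comp hi hj

lemma of_comp (hX : IsReedyFibration (toUnit X)) {K L M : SSet.{u}} {i : K ⟶ L} {j : L ⟶ M}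
    [Mono j] (hi : IsLocal X i) (hij : IsLocal X (i ≫ j)) : IsLocal X j := by
  rw [IsLocal, Functor.map_comp] at hij
  exact IsOrthogonal.of_comp hX hi hij

lemma of_isIso {K L : SSet.{u}} (i : K ⟶ L) [IsIso i] : IsLocal X i :=
  IsOrthogonal.of_isIso _ _

lemma homOfLE_of_eq {L : SSet.{u}} {U V : L.Subcomplex} (h : U ≤ V) (e : U = V) :
    IsLocal X (Subcomplex.homOfLE h) := by
  subst e
  exact of_isIso (𝟙 _)

lemma of_arrow_iso {K L K' L' : SSet.{u}} {i : K ⟶ L} {j : K' ⟶ L'}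
    (e : Arrow.mk j ≅ Arrow.mk i) (h : IsLocal X i) : IsLocal X j :=
  IsOrthogonal.of_arrow_iso (discrete.mapArrow.mapIso e) h

lemma of_ι_range {K L : SSet.{u}} {i : K ⟶ L} [Mono i] (h : IsLocal X (Subcomplex.range i).ι) :
    IsLocal X i :=
  h.of_arrow_iso (Arrow.isoMk
    (asIso (Subcomplex.toRange i) : K ≅ (Subcomplex.range i : SSet.{u})) (Iso.refl _))

/-- Attaching a simplicial subset along an injective map. -/
lemma sup_range {L M : SSet.{u}} (s : M ⟶ L) [Mono s] {U V : L.Subcomplex} (hUV : U ≤ V)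
    (hV : V = U ⊔ Subcomplex.range s) (h : IsLocal X (U.preimage s).ι) :
    IsLocal X (Subcomplex.homOfLE hUV) := by
  subst hV
  have sq : Subcomplex.BicartSq (U ⊓ Subcomplex.range s) U (Subcomplex.range s)
    (U ⊔ Subcomplex.range s) := { sup_eq := rfl, inf_eq := rfl }
  -- Since `s` is injective, it identifies its preimage of `U` with `U ∩ range s`, so the union is a
  -- pushout along the inclusion of that preimage.
  let f : (U.preimage s : SSet.{u}) ⟶ (U ⊓ Subcomplex.range s : L.Subcomplex) :=
    Subcomplex.lift ((U.preimage s).ι ≫ s) (by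
      rintro m _ ⟨x, rfl⟩
      exact ⟨x.2, x.1, rfl⟩)
  have : Mono f := mono_of_mono_fac (h := (U.preimage s).ι ≫ s)
    (show f ≫ Subcomplex.ι _ = (U.preimage s).ι ≫ s from rfl)
  have : Epi f := by
    rw [← Subcomplex.range_eq_top_iff]
    refine le_antisymm le_top ?_
    rintro m ⟨_, hx, x, rfl⟩ -
    exact ⟨⟨x, hx⟩, rfl⟩
  have : IsIso f := isIso_of_mono_of_epi f
  exact IsOrthogonal.of_isPushout (sq.isPushout.map discrete)
    (h.of_arrow_iso (Arrow.isoMk (asIso f) (asIso (Subcomplex.toRange s))).symm)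

end IsLocal

/-! ### Simplices of standard simplices -/

/-- The value of a simplex of `Δ[n]` at a vertex, as a natural number. -/
abbrev val {n : ℕ} {m} (s : (Δ[n] : SSet.{u}).obj m) (a : Fin (m.unop.len + 1)) : ℕ :=
  (stdSimplex.asOrderHom s a : ℕ)

lemma val_mono {n : ℕ} {m} (s : (Δ[n] : SSet.{u}).obj m) {a b : Fin (m.unop.len + 1)}
    (h : a ≤ b) : val s a ≤ val s b :=
  (stdSimplex.asOrderHom s).monotone h

lemma val_le {n : ℕ} {m} (s : (Δ[n] : SSet.{u}).obj m) (a : Fin (m.unop.len + 1)) :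
    val s a ≤ n :=
  Nat.lt_succ_iff.1 (stdSimplex.asOrderHom s a).2

lemma ext_val {n : ℕ} {m} {s t : (Δ[n] : SSet.{u}).obj m} (h : ∀ a, val s a = val t a) :
    s = t := by
  apply stdSimplex.objEquiv.injective
  ext a : 3
  exact Fin.ext (h a)

lemma exists_val_eq {n : ℕ} {m} (f : Fin (SimplexCategory.len m.unop + 1) → ℕ) (hf : Monotone f)
    (hf' : ∀ a, f a ≤ n) : ∃ s : (Δ[n] : SSet.{u}).obj m, ∀ a, val s a = f a :=
  ⟨stdSimplex.objMk ⟨fun a ↦ ⟨f a, Nat.lt_succ_iff.2 (hf' a)⟩, fun _ _ h ↦ hf h⟩, fun _ ↦ rfl⟩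

/-- The map of standard simplices given by a monotone function on vertices. -/
def ofMonotone {p q : ℕ} (f : ℕ → ℕ) (hf : Monotone f) (hf' : ∀ a, a ≤ p → f a ≤ q) :
    (Δ[p] : SSet.{u}) ⟶ Δ[q] :=
  SSet.stdSimplex.map (SimplexCategory.Hom.mk
    ⟨fun a ↦ ⟨f a, Nat.lt_succ_iff.2 (hf' a (Nat.lt_succ_iff.1 a.2))⟩, fun _ _ h ↦ hf h⟩)

lemma mem_spine_iff {n : ℕ} {m} (s : (Δ[n] : SSet.{u}).obj m) :
    s ∈ (spine n).obj m ↔ ∀ a b, val s b ≤ val s a + 1 := Iff.rfl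

lemma mono_of_injective {K L : SSet.{u}} (f : K ⟶ L)
    (h : ∀ m (x y : K.obj m), f.app m x = f.app m y → x = y) : Mono f := by
  rw [NatTrans.mono_iff_mono_app]
  exact fun m ↦ (mono_iff_injective _).2 fun x y hxy ↦ h m x y hxy

section

variable {X : BiSSet.{u}}

/-! ### The spine of a prism -/

/-- The simplices of `Δ[n]` whose values lie in `{j, j + 1, j + 2}`. -/
def triangleAt (n j : ℕ) : (Δ[n] : SSet.{u}).Subcomplex where
  obj _ := {s | ∀ a, j ≤ val s a ∧ val s a ≤ j + 2}
  map φ _ hs a := hs (φ.unop.toOrderHom a)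

/-- The map `Δ[2] ⟶ Δ[n]` onto the triangle `{j, j + 1, j + 2}`. -/
def triangleMap {n j : ℕ} (h : j + 2 ≤ n) : (Δ[2] : SSet.{u}) ⟶ Δ[n] :=
  ofMonotone (j + ·) (fun _ _ h ↦ Nat.add_le_add_left h j) (fun _ ha ↦ by omega)

lemma val_triangleMap {n j : ℕ} (h : j + 2 ≤ n) {m} (s : (Δ[2] : SSet.{u}).obj m) (a) :
    val ((triangleMap h).app m s) a = j + val s a := rfl

instance {n j : ℕ} (h : j + 2 ≤ n) : Mono (triangleMap.{u} h) :=
  mono_of_injective _ fun m x y hxy ↦ ext_val fun a ↦ by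
    have := congr(val $hxy a)
    rw [val_triangleMap, val_triangleMap] at this
    omega

lemma range_triangleMap {n j : ℕ} (h : j + 2 ≤ n) :
    Subcomplex.range (triangleMap.{u} h) = triangleAt n j := by
  ext m s
  constructor
  · rintro ⟨t, rfl⟩ a
    have := val_le t a
    rw [val_triangleMap]
    omega
  · intro hs
    obtain ⟨t, ht⟩ := exists_val_eq.{u} (n := 2) (m := m) (fun a ↦ val s a - j)
      (fun a b hab ↦ Nat.sub_le_sub_right (val_mono s hab) j) (fun a ↦ by have := hs a; omega)
    refine ⟨t, ext_val fun a ↦ ?_⟩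
    have := hs a
    rw [val_triangleMap, ht]
    omega

/-- Attaching a triangle to a simplicial subset that meets it in its spine. -/
lemma IsLocal.sup_triangleAt (hX : IsSegalSpace X) {n : ℕ} (j : ℕ)
    {U V : (Δ[n] : SSet.{u}).Subcomplex} (hUV : U ≤ V) (hV : V = U ⊔ triangleAt n j)
    (hU : spine n ≤ U)
    (h : ∀ m (s : (Δ[n] : SSet.{u}).obj m), s ∈ U.obj m → s ∈ (triangleAt n j).obj m →
      s ∈ (spine n).obj m) :
    IsLocal X (Subcomplex.homOfLE hUV) := by
  by_cases hj : j + 2 ≤ n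
  · refine IsLocal.sup_range (triangleMap hj) hUV (by rw [range_triangleMap, hV]) ?_
    have : U.preimage (triangleMap hj) = spine 2 := by
      ext m s
      have h₀ : s ∈ (spine 2).obj m ↔ (triangleMap hj).app m s ∈ (spine n).obj m := by
        rw [mem_spine_iff, mem_spine_iff]
        simp only [val_triangleMap, Nat.add_assoc, Nat.add_le_add_iff_left]
      rw [h₀]
      refine ⟨fun hs ↦ h m _ hs ?_, fun hs ↦ hU _ hs⟩
      rw [← range_triangleMap hj]
      exact ⟨s, rfl⟩
    rw [this]
    exact (isSegalSpace_iff.1 hX).2 2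
  -- When `j + 2 > n` at most one edge remains of the triangle, so nothing is attached.
  · have : triangleAt n j ≤ spine n := fun m s hs ↦ by
      intro a b
      change val s b ≤ val s a + 1
      have := hs a
      have := val_le s b
      omega
    exact IsLocal.homOfLE_of_eq _ ((sup_eq_left.2 (this.trans hU)).symm.trans hV.symm)

/-- The map that repeats the vertex `k`. -/
def collapse (k a : ℕ) : ℕ := if a ≤ k then a else a - 1

lemma collapse_monotone (k : ℕ) : Monotone (collapse k) := by
  intro a b h
  dsimp only [collapse]
  split_ifs <;> omega

/-- The inverse image of the spine under the degeneracy that repeats the vertex `k`. -/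
def thickSpine (n k : ℕ) : (Δ[n + 1] : SSet.{u}).Subcomplex where
  obj _ := {s | ∀ a b, collapse k (val s b) ≤ collapse k (val s a) + 1}
  map φ _ hs a b := hs (φ.unop.toOrderHom a) (φ.unop.toOrderHom b)

lemma spine_le_thickSpine (n k : ℕ) : spine.{u} (n + 1) ≤ thickSpine n k := by
  intro m s hs a b
  have := hs a b
  change val s b ≤ val s a + 1 at this
  dsimp only [collapse]
  split_ifs <;> omega

/-- The part of `thickSpine n k` that contains one of its two triangles. -/
def thinSpine (n k : ℕ) : (Δ[n + 1] : SSet.{u}).Subcomplex :=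
  if k = 0 then spine (n + 1) else spine (n + 1) ⊔ triangleAt (n + 1) (k - 1)

/-- The degeneracy identifies `k` and `k + 1`. The edges `{k - 1, k}` and `{k, k + 1}` pull back to
the triangles at `k - 1` and `k`; the other edges pull back to edges. -/
lemma thickSpine_eq (n k : ℕ) :
    thickSpine.{u} n k = thinSpine n k ⊔ triangleAt (n + 1) k := by
  have h (j : ℕ) (hj : j ≤ k) (hj' : k ≤ j + 1) :
      triangleAt.{u} (n + 1) j ≤ thickSpine n k := fun m s hs a b ↦ by
    have := hs a
    have := hs b
    dsimp only [collapse]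
    split_ifs <;> omega
  refine le_antisymm (fun m s hs ↦ ?_) (sup_le ?_ (h k le_rfl (Nat.le_succ k)))
  · by_cases hs' : s ∈ (spine (n + 1)).obj m
    · refine Or.inl ?_
      dsimp only [thinSpine]
      split_ifs
      · exact hs'
      · exact Or.inl hs'
    · rw [mem_spine_iff] at hs'
      push Not at hs'
      obtain ⟨a, b, hab⟩ := hs'
      have h₀ : val s a ≤ k ∧ k ≤ val s a + 1 ∧ val s b = val s a + 2 := by
        have := hs a b
        dsimp only [collapse] at this
        split_ifs at this <;> omega
      have h₁ : s ∈ (triangleAt (n + 1) (val s a)).obj m := fun c ↦ by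
        have h₁ := hs a c
        have h₂ := hs c b
        dsimp only [collapse] at h₁ h₂
        split_ifs at h₁ h₂ <;> omega
      obtain h₂ | h₂ : val s a = k ∨ (k ≠ 0 ∧ val s a = k - 1) := by omega
      · rw [h₂] at h₁
        exact Or.inr h₁
      · rw [h₂.2] at h₁
        rw [thinSpine, if_neg h₂.1]
        exact Or.inl (Or.inr h₁)
  · dsimp only [thinSpine]
    split_ifs with hk
    · exact spine_le_thickSpine n k
    · exact sup_le (spine_le_thickSpine n k) (h _ (by omega) (by omega))

lemma IsLocal.spine_thickSpine (hX : IsSegalSpace X) (n k : ℕ) :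
    IsLocal X (Subcomplex.homOfLE (spine_le_thickSpine.{u} n k)) := by
  have h₁ : spine.{u} (n + 1) ≤ thinSpine n k := by
    dsimp only [thinSpine]
    split_ifs
    · rfl
    · exact le_sup_left
  have h₂ : thinSpine.{u} n k ≤ thickSpine n k := by
    rw [thickSpine_eq]
    exact le_sup_left
  have : Subcomplex.homOfLE (spine_le_thickSpine.{u} n k) =
    Subcomplex.homOfLE h₁ ≫ Subcomplex.homOfLE h₂ := rfl
  rw [this]
  refine IsLocal.comp ?_ (IsLocal.sup_triangleAt hX k h₂ (thickSpine_eq n k) h₁ ?_)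
  · by_cases hk : k = 0
    · exact IsLocal.homOfLE_of_eq _ (if_pos hk).symm
    · exact IsLocal.sup_triangleAt hX (k - 1) h₁ (if_neg hk) le_rfl (fun _ _ h _ ↦ h)
  -- The two triangles meet in the edge `{k, k + 1}`, which belongs to the spine.
  · intro m s hs hs'
    by_cases hk : k = 0
    · rwa [thinSpine, if_pos hk] at hs
    · rw [thinSpine, if_neg hk] at hs
      obtain hs | hs := hs
      · exact hs
      · intro a b
        change val s b ≤ val s a + 1
        have := hs b
        have := hs' a
        omega

/-- The spine is local both in `thickSpine n k` and in `Δ[n + 1]`, so the first factor can be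
cancelled. -/
lemma IsLocal.thickSpine (hX : IsSegalSpace X) (n k : ℕ) :
    IsLocal X (thickSpine.{u} n k).ι :=
  IsLocal.of_comp hX.reedyFibrant (IsLocal.spine_thickSpine hX n k)
    ((isSegalSpace_iff.1 hX).2 (n + 1))

/-! ### Filtration of the prism by shuffles -/

/-- The simplices of `Δ[n + 1]` that do not have `k` as a vertex. -/
def avoiding (n k : ℕ) : (Δ[n + 1] : SSet.{u}).Subcomplex where
  obj _ := {s | ∀ a, val s a ≠ k}
  map φ _ hs a := hs (φ.unop.toOrderHom a)

/-- The injective map that avoids `k`. -/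
def skip (k a : ℕ) : ℕ := if a < k then a else a + 1

/-- The inclusion of the face that does not contain `k`. -/
def faceMap (n k : ℕ) : (Δ[n] : SSet.{u}) ⟶ Δ[n + 1] :=
  ofMonotone (skip k) (fun a b h ↦ by dsimp only [skip]; split_ifs <;> omega)
    (fun a h ↦ by dsimp only [skip]; split_ifs <;> omega)

lemma val_faceMap (n k : ℕ) {m} (s : (Δ[n] : SSet.{u}).obj m) (a) :
    val ((faceMap n k).app m s) a = skip k (val s a) := rfl

instance (n k : ℕ) : Mono (faceMap.{u} n k) :=
  mono_of_injective _ fun m x y hxy ↦ ext_val fun a ↦ by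
    have := congr(val $hxy a)
    rw [val_faceMap, val_faceMap] at this
    dsimp only [skip] at this
    split_ifs at this <;> omega

lemma range_faceMap {n k : ℕ} (hk : k ≤ n) :
    Subcomplex.range (faceMap.{u} n k) = avoiding n k := by
  ext m s
  constructor
  · rintro ⟨t, rfl⟩ a
    rw [val_faceMap]
    dsimp only [skip]
    split_ifs <;> omega
  · intro hs
    obtain ⟨t, ht⟩ := exists_val_eq.{u} (n := n) (m := m) (fun a ↦ collapse k (val s a))
      (fun a b hab ↦ collapse_monotone k (val_mono s hab)) (fun a ↦ by
        have := val_le s a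
        dsimp only [collapse]
        split_ifs <;> omega)
    refine ⟨t, ext_val fun a ↦ ?_⟩
    have : val s a ≠ k := hs a
    rw [val_faceMap, ht]
    dsimp only [collapse, skip]
    split_ifs <;> omega

/-- The face map that skips `k` is a section of the degeneracy that repeats `k`, so this face meets
`thickSpine n k` exactly in its own spine. Attaching it is therefore local, and cancellation applies
again. -/
lemma IsLocal.thickSpine_sup_avoiding (hX : IsSegalSpace X) {n k : ℕ} (hk : k ≤ n) :
    IsLocal X (BiSSet.thickSpine.{u} n k ⊔ avoiding n k).ι := by
  have h : IsLocal X (Subcomplex.homOfLE (le_sup_left :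
      BiSSet.thickSpine.{u} n k ≤ BiSSet.thickSpine n k ⊔ avoiding n k)) := by
    refine IsLocal.sup_range (faceMap n k) _ (by rw [range_faceMap hk]) ?_
    have : (BiSSet.thickSpine.{u} n k).preimage (faceMap n k) = spine n := by
      ext m s
      have h₀ (a) : collapse k (skip k (val s a)) = val s a := by
        dsimp only [collapse, skip]
        split_ifs <;> omega
      have h₁ : (faceMap n k).app m s ∈ (BiSSet.thickSpine n k).obj m ↔
        ∀ a b, collapse k (skip k (val s b)) ≤ collapse k (skip k (val s a)) + 1 := Iff.rfl
      simp only [h₀] at h₁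
      exact h₁
    rw [this]
    exact (isSegalSpace_iff.1 hX).2 n
  exact IsLocal.of_comp hX.reedyFibrant h (IsLocal.thickSpine hX n k)

/-- A stage of the filtration of the prism. -/
def prismStage (n k : ℕ) : ((Δ[n] : SSet.{u}) ⊗ Δ[1]).Subcomplex where
  obj _ := {z | (∀ a b, val z.1 b ≤ val z.1 a + 1) ∨ ∃ i < k, ∀ a,
    (val z.2 a = 0 → val z.1 a ≤ i) ∧ (val z.2 a = 1 → i ≤ val z.1 a)}
  map φ z hz := by
    obtain hz | ⟨i, hi, hz⟩ := hz
    · exact Or.inl fun a b ↦ hz (φ.unop.toOrderHom a) (φ.unop.toOrderHom b)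
    · exact Or.inr ⟨i, hi, fun a ↦ hz (φ.unop.toOrderHom a)⟩

lemma prismStage_mono (n : ℕ) {k l : ℕ} (h : k ≤ l) : prismStage.{u} n k ≤ prismStage n l := by
  intro m z hz
  obtain hz | ⟨i, hi, hz⟩ := hz
  · exact Or.inl hz
  · exact Or.inr ⟨i, lt_of_lt_of_le hi h, hz⟩

/-- The shuffles of the prism. -/
def shuffle {n k : ℕ} (hk : k ≤ n) : (Δ[n + 1] : SSet.{u}) ⟶ Δ[n] ⊗ Δ[1] :=
  lift (ofMonotone (collapse k) (collapse_monotone k)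
      (fun a h ↦ by dsimp only [collapse]; split_ifs <;> omega))
    (ofMonotone (fun a ↦ if a ≤ k then 0 else 1)
      (fun a b h ↦ by dsimp only; split_ifs <;> omega) (fun a h ↦ by split_ifs <;> omega))

lemma val_shuffle_fst {n k : ℕ} (hk : k ≤ n) {m} (s : (Δ[n + 1] : SSet.{u}).obj m) (a) :
    val ((shuffle hk).app m s).1 a = collapse k (val s a) := rfl

lemma val_shuffle_snd {n k : ℕ} (hk : k ≤ n) {m} (s : (Δ[n + 1] : SSet.{u}).obj m) (a) :
    val ((shuffle hk).app m s).2 a = if val s a ≤ k then 0 else 1 := rfl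

instance {n k : ℕ} (hk : k ≤ n) : Mono (shuffle.{u} hk) :=
  mono_of_injective _ fun m x y hxy ↦ ext_val fun a ↦ by
    have h₁ := congr(val $(hxy).1 a)
    have h₂ := congr(val $(hxy).2 a)
    rw [val_shuffle_fst, val_shuffle_fst] at h₁
    rw [val_shuffle_snd, val_shuffle_snd] at h₂
    dsimp only [collapse] at h₁
    split_ifs at h₁ h₂ <;> omega

lemma prismStage_succ {n k : ℕ} (hk : k ≤ n) :
    prismStage.{u} n (k + 1) = prismStage n k ⊔ Subcomplex.range (shuffle hk) := by
  refine le_antisymm ?_ (sup_le (prismStage_mono n (Nat.le_succ k)) ?_)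
  · rintro m z (hz | ⟨i, hi, hz⟩)
    · exact Or.inl (Or.inl hz)
    · obtain hi | rfl := Nat.lt_succ_iff_lt_or_eq.1 hi
      · exact Or.inl (Or.inr ⟨i, hi, hz⟩)
      -- The `k`-th shuffle is the path `(0,0), …, (k,0), (k,1), …, (n,1)`; the position of a vertex
      -- on it is the sum of its coordinates.
      · obtain ⟨t, ht⟩ := exists_val_eq.{u} (n := n + 1) (m := m) (fun a ↦ val z.1 a + val z.2 a)
          (fun a b hab ↦ Nat.add_le_add (val_mono z.1 hab) (val_mono z.2 hab)) (fun a ↦ by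
            have := val_le z.1 a
            have := val_le z.2 a
            omega)
        refine Or.inr ⟨t, Prod.ext (ext_val fun a ↦ ?_) (ext_val fun a ↦ ?_)⟩
        · have := hz a
          have := val_le z.2 a
          rw [val_shuffle_fst, ht]
          dsimp only [collapse]
          split_ifs <;> omega
        · have := hz a
          have := val_le z.2 a
          rw [val_shuffle_snd, ht]
          split_ifs <;> omega
  · rintro m _ ⟨t, rfl⟩
    refine Or.inr ⟨k, Nat.lt_succ_self k, fun a ↦ ?_⟩
    rw [val_shuffle_fst, val_shuffle_snd]
    dsimp only [collapse]
    refine ⟨fun h ↦ ?_, fun h ↦ ?_⟩ <;> split_ifs at h ⊢ <;> omega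

/-- The part over the spine pulls back along the degeneracy to `thickSpine n k`. An earlier shuffle
misses the vertex `(k,0)`, which has position `k`, and the shuffle `k - 1` contains every other
vertex; for `k = 0` there is no earlier one. -/
lemma preimage_shuffle {n k : ℕ} (hk : k ≤ n) :
    (prismStage.{u} n k).preimage (shuffle hk) =
      if k = 0 then thickSpine n k else thickSpine n k ⊔ avoiding n k := by
  have h (m) (s : (Δ[n + 1] : SSet.{u}).obj m) :
      s ∈ ((prismStage.{u} n k).preimage (shuffle hk)).obj m ↔
      s ∈ (thickSpine n k).obj m ∨ ∃ i < k, ∀ a,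
        ((if val s a ≤ k then 0 else 1) = 0 → collapse k (val s a) ≤ i) ∧
        ((if val s a ≤ k then 0 else 1) = 1 → i ≤ collapse k (val s a)) := Iff.rfl
  ext m s
  rw [h]
  by_cases hk₀ : k = 0
  · rw [if_pos hk₀]
    refine ⟨?_, Or.inl⟩
    rintro (hs | ⟨i, hi, -⟩)
    · exact hs
    · omega
  · rw [if_neg hk₀]
    refine or_congr_right ⟨?_, fun hs ↦ ⟨k - 1, by omega, fun a ↦ ?_⟩⟩
    · rintro ⟨i, hi, hs⟩ a ha
      have := (hs a).1 (if_pos ha.le)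
      dsimp only [collapse] at this
      rw [if_pos ha.le] at this
      omega
    · have : val s a ≠ k := hs a
      dsimp only [collapse]
      refine ⟨fun h ↦ ?_, fun h ↦ ?_⟩ <;> split_ifs at h ⊢ <;> omega

lemma IsLocal.prismStage_succ (hX : IsSegalSpace X) {n k : ℕ} (hk : k ≤ n) :
    IsLocal X (Subcomplex.homOfLE (prismStage_mono.{u} n (Nat.le_succ k))) := by
  refine IsLocal.sup_range (shuffle hk) _ (BiSSet.prismStage_succ hk) ?_
  by_cases hk₀ : k = 0
  · rw [(preimage_shuffle hk).trans (if_pos hk₀)]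
    exact IsLocal.thickSpine hX n k
  · rw [(preimage_shuffle hk).trans (if_neg hk₀)]
    exact IsLocal.thickSpine_sup_avoiding hX hk

lemma prismStage_last (n : ℕ) : prismStage.{u} n (n + 1) = ⊤ := by
  rw [eq_top_iff]
  intro m z _
  refine Or.inr ?_
  by_cases h : ∃ a, val z.2 a = 0
  · obtain ⟨a, ha, hmax⟩ := Set.exists_max_image {a | val z.2 a = 0} id (Set.toFinite _) h
    refine ⟨val z.1 a, Nat.lt_succ_iff.2 (val_le z.1 a),
      fun b ↦ ⟨fun hb ↦ val_mono z.1 (hmax b hb), fun hb ↦ val_mono z.1 ?_⟩⟩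
    by_contra! hlt
    have := val_mono z.2 hlt.le
    have ha' : val z.2 a = 0 := ha
    omega
  · push Not at h
    exact ⟨0, Nat.succ_pos n, fun a ↦ ⟨fun ha ↦ (h a ha).elim, fun _ ↦ Nat.zero_le _⟩⟩

lemma IsLocal.prismStage_le (hX : IsSegalSpace X) {n k : ℕ} (hk : k ≤ n + 1) :
    IsLocal X (Subcomplex.homOfLE (prismStage_mono.{u} n (Nat.zero_le k))) := by
  induction k with
  | zero => exact IsLocal.homOfLE_of_eq _ rfl
  | succ k IH =>
    have := (IH (by omega)).comp (IsLocal.prismStage_succ hX (Nat.lt_succ_iff.1 hk))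
    rwa [Subcomplex.homOfLE_comp] at this

lemma IsLocal.prismStage_zero (hX : IsSegalSpace X) (n : ℕ) :
    IsLocal X (prismStage.{u} n 0).ι := by
  have h := IsLocal.prismStage_le hX (le_refl (n + 1))
  have h' : IsIso (prismStage.{u} n (n + 1)).ι := by
    rw [prismStage_last]
    exact inferInstanceAs (IsIso (Subcomplex.topIso _).hom)
  rw [← Subcomplex.homOfLE_ι (prismStage_mono.{u} n (Nat.zero_le (n + 1)))]
  exact h.comp (IsLocal.of_isIso _)

/-- The product of a spine with the interval. -/
lemma IsLocal.spine_whiskerRight (hX : IsSegalSpace X) (n : ℕ) :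
    IsLocal X ((spine.{u} n).ι ▷ Δ[1]) := by
  have : Mono ((spine.{u} n).ι ▷ Δ[1]) :=
    mono_of_injective _ fun m x y hxy ↦ Prod.ext (Subtype.ext (congr($(hxy).1))) (congr($(hxy).2))
  refine IsLocal.of_ι_range ?_
  have : Subcomplex.range ((spine.{u} n).ι ▷ Δ[1]) = prismStage n 0 := by
    refine le_antisymm ?_ ?_
    · rintro m _ ⟨z, rfl⟩
      exact Or.inl z.1.2
    · rintro m z (hz | ⟨i, hi, -⟩)
      · exact ⟨(⟨z.1, hz⟩, z.2), rfl⟩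
      · omega
  rw [this]
  exact IsLocal.prismStage_zero hX n

end

/-! ### Orthogonality and exponentials -/

lemma isOrthogonal_expo_post_iff {A K L X Y : BiSSet.{u}} {i : K ⟶ L} {f : X ⟶ Y} :
    IsOrthogonal i (expo.post A f) ↔ IsOrthogonal (A ◁ i) f :=
  forall_congr' fun _ ↦ (hasLiftingProperty_expo_post_iff _ _).symm.trans
    (hasLiftingProperty_whiskerLeft_leibniz_iff _ _ _)

lemma hasLiftingProperty_iff_of_isTerminal {K L X Y Z : BiSSet.{u}} (i : K ⟶ L) (f : X ⟶ Y)
    (g : X ⟶ Z) (hY : IsTerminal Y) (hZ : IsTerminal Z) :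
    HasLiftingProperty i f ↔ HasLiftingProperty i g :=
  HasLiftingProperty.iff_of_arrow_iso_right i
    (Arrow.isoMk (Iso.refl _) (hY.uniqueUpToIso hZ) (hZ.hom_ext _ _))

/-- The internal hom into the point is the point. -/
def isTerminalExpoUnit (A : BiSSet.{u}) : IsTerminal (expo A (𝟙_ BiSSet.{u})) :=
  have := (tensorExpoAdj A).rightAdjoint_preservesLimits
  IsTerminal.isTerminalObj (expoFunctor A) _ isTerminalUnit

lemma isOrthogonal_toUnit_expo_iff {A K L X : BiSSet.{u}} {i : K ⟶ L} :
    IsOrthogonal i (toUnit (expo A X)) ↔ IsOrthogonal (A ◁ i) (toUnit X) := by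
  rw [← isOrthogonal_expo_post_iff]
  exact forall_congr' fun m ↦ hasLiftingProperty_iff_of_isTerminal _ _ _ isTerminalUnit
    (isTerminalExpoUnit A)

lemma IsReedyFibration.expo {X : BiSSet.{u}} (hX : IsReedyFibration (toUnit X)) (A : BiSSet.{u}) :
    IsReedyFibration (toUnit (expo A X)) := by
  have := hX.expo_post A
  rw [isReedyFibration_iff] at this ⊢
  exact fun n _ _ j hj ↦ (hasLiftingProperty_iff_of_isTerminal _ _ _ isTerminalUnit
    (isTerminalExpoUnit A)).2 (this n j hj)

/-- By adjunction, the Segal condition for the exponential is a condition on `X` alone. -/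
lemma isSegalSpace_expo_iff {A X : BiSSet.{u}} (hX : IsReedyFibration (toUnit X)) :
    IsSegalSpace (expo A X) ↔ ∀ n, IsOrthogonal (A ◁ spineIncl n) (toUnit X) := by
  rw [isSegalSpace_iff]
  simp only [isOrthogonal_toUnit_expo_iff]
  exact and_iff_right (hX.expo A)

lemma IsSegalSpace.expo_interval {X : BiSSet.{u}} (hX : IsSegalSpace X) :
    IsSegalSpace (expo (F.obj ⦋1⦌) X) := by
  rw [isSegalSpace_expo_iff hX.reedyFibrant]
  intro n
  have : IsOrthogonal (spineIncl n ▷ F.obj ⦋1⦌) (toUnit X) := IsLocal.spine_whiskerRight hX n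
  exact this.of_arrow_iso (Arrow.isoMk (β_ _ _) (β_ _ _)
    (BraidedCategory.braiding_naturality_right _ _).symm)

lemma IsSegalSpace.expo_tensor {X : BiSSet.{u}} (hX : IsReedyFibration (toUnit X))
    {A A' : BiSSet.{u}} (h : IsSegalSpace (BiSSet.expo A' (BiSSet.expo A X))) :
    IsSegalSpace (BiSSet.expo (A ⊗ A') X) := by
  rw [isSegalSpace_expo_iff hX]
  rw [isSegalSpace_expo_iff (hX.expo A)] at h
  exact fun n ↦ (isOrthogonal_toUnit_expo_iff.1 (h n)).of_arrow_iso
    (Arrow.isoMk (α_ _ _ _) (α_ _ _ _) (by simp))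

lemma IsSegalSpace.expo_retract {X : BiSSet.{u}} (hX : IsReedyFibration (toUnit X))
    {A A' : BiSSet.{u}} (r : Retract A A') (h : IsSegalSpace (BiSSet.expo A' X)) :
    IsSegalSpace (BiSSet.expo A X) := by
  rw [isSegalSpace_expo_iff hX] at h ⊢
  refine fun n ↦ (h n).of_retract
    { i := Arrow.homMk (r.i ▷ _) (r.i ▷ _) (whisker_exchange _ _).symm
      r := Arrow.homMk (r.r ▷ _) (r.r ▷ _) (whisker_exchange _ _).symm
      retract := ?_ }
  ext : 1
  · change r.i ▷ _ ≫ r.r ▷ _ = 𝟙 _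
    rw [← comp_whiskerRight, r.retract, id_whiskerRight]
  · change r.i ▷ _ ≫ r.r ▷ _ = 𝟙 _
    rw [← comp_whiskerRight, r.retract, id_whiskerRight]

/-! ### Exponentials by simplices -/

/-- A point is a retract of an interval. -/
def retractPoint : Retract (Δ[0] : SSet.{u}) Δ[1] where
  i := SSet.stdSimplex.δ (0 : Fin 2)
  r := SSet.stdSimplex.σ (0 : Fin 1)
  retract := SSet.stdSimplex.isTerminalObj₀.hom_ext _ _

/-- A simplex is a retract of a prism. -/
def retractPrism (p : ℕ) : Retract (Δ[p + 1] : SSet.{u}) (Δ[p] ⊗ Δ[1]) where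
  -- The section is the path `(0,0), …, (p,0), (p,1)`; the retraction sends all of `Δ[p] × {1}` to
  -- the vertex `p + 1`.
  i := lift (ofMonotone (fun a ↦ min a p) (fun a b h ↦ min_le_min_right p h)
      (fun a _ ↦ min_le_right a p))
    (ofMonotone (fun a ↦ a - p) (fun a b h ↦ Nat.sub_le_sub_right h p) (fun a h ↦ by omega))
  r :=
    { app m := ↾fun z ↦ stdSimplex.objMk
        ⟨fun a ↦ if val z.2 a = 0
          then ⟨val z.1 a, Nat.lt_succ_of_le ((val_le z.1 a).trans (Nat.le_succ p))⟩
          else Fin.last _,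
          fun a b h ↦ by
            have h₁ := val_mono z.1 h
            have h₂ := val_mono z.2 h
            dsimp only
            split_ifs
            · exact h₁
            · exact Fin.le_last _
            · omega
            · rfl⟩
      naturality m m' f := rfl }
  retract := by
    ext m s
    refine ext_val fun a ↦ ?_
    change ((if val s a - p = 0 then ⟨min (val s a) p, _⟩ else Fin.last _ : Fin (p + 2)) : ℕ) =
      val s a
    have := val_le s a
    split_ifs
    · dsimp only
      omega
    · dsimp only [Fin.val_last]
      omega

/-- `X^{F(p) × F(1)}` is `(X^{F(p)})^{F(1)}`, so the interval case applied to `X^{F(p)}` and a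
retract give the inductive step. -/
lemma IsSegalSpace.expo_F {X : BiSSet.{u}} (hX : IsSegalSpace X) (p : ℕ) :
    IsSegalSpace (expo (F.obj ⦋p⦌) X) := by
  induction p with
  | zero => exact hX.expo_interval.expo_retract hX.reedyFibrant (retractPoint.map discrete)
  | succ p IH =>
    exact (IH.expo_interval.expo_tensor hX.reedyFibrant).expo_retract hX.reedyFibrant
      ((retractPrism p).map discrete)

/-! ### Maps that are equivalences at each level -/

lemma isOrthogonal_initial_iff {A X Y : BiSSet.{u}} {f : X ⟶ Y} :
    IsOrthogonal (initial.to A) f ↔ SSet.IsTrivialFibration (Map.post A f) := by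
  have h (m : ℕ) : HasLiftingProperty (leibniz (initial.to A) (constant.map ∂Δ[m].ι)) f ↔
      HasLiftingProperty ∂Δ[m].ι (Map.post A f) :=
    (hasLiftingProperty_initial_iff (initialIsInitial (C := BiSSet.{u})) _ f).trans
      (hasLiftingProperty_map_post_iff _ f)
  simp only [IsOrthogonal, h]
  exact ⟨fun h _ _ _ ⟨m⟩ ↦ h m, fun h m ↦ h _ ⟨m⟩⟩

/-- The cellular criterion, with the extra factor `∂Δ[m] → Δ[m]` absorbed: its pushout-product with
`∂Δ[q] → Δ[q]` is a monomorphism, which orthogonality already handles. -/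
lemma isOrthogonal_of_boundary {A A' X Y : BiSSet.{u}} (i : A ⟶ A') [Mono i] {f : X ⟶ Y}
    (D : ℕ → Prop) (hf : ∀ p, D p → IsOrthogonal (boundaryIncl p) f)
    (hi : ∀ (p q : ℕ) (z : (A'.obj (op ⦋p⦌)).obj (op ⦋q⦌)), ¬ D p →
      (∃ w, (i.app _).app _ w = z) ∨
        ∃ (r : SimplexCategory) (s : ⦋p⦌ ⟶ r) (w : (A'.obj (op r)).obj (op ⦋q⦌)),
          r.len < p ∧ act s (𝟙 _) w = z) :
    IsOrthogonal i f := by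
  rw [isOrthogonal_iff_expoHom]
  intro m
  refine hasLiftingProperty_of_mono i _ D (fun p q hp ↦ ?_) hi
  refine (hasLiftingProperty_expoHom_iff' _ _ _).1 ((hasLiftingProperty_leibniz_constant_iff
    (boundaryIncl p) (Subcomplex.unionProd.pushoutObjObj ∂Δ[q] ∂Δ[m]) f).2 ?_)
  exact (hf p hp).hasLiftingProperty (Subcomplex.unionProd ∂Δ[q] ∂Δ[m]).ι

lemma isTrivialFibration_of_isPullback {E E' B B' : SSet.{u}} {t : E' ⟶ E} {p' : E' ⟶ B'}
    {p : E ⟶ B} {b : B' ⟶ B} (sq : IsPullback t p' p b) (hp : SSet.IsTrivialFibration p) :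
    SSet.IsTrivialFibration p' :=
  MorphismProperty.of_isPullback sq hp

/-- The relative matching map is a fibration, and `Map.post A' f` is its composite with a base
change of `Map.post A f`; cancellation of trivial fibrations applies. -/
lemma IsReedyFibration.isOrthogonal_of_map_post {A A' X Y : BiSSet.{u}} {f : X ⟶ Y}
    (hf : IsReedyFibration f) (i : A ⟶ A') [Mono i]
    (h : SSet.IsTrivialFibration (Map.post A f)) (h' : SSet.IsTrivialFibration (Map.post A' f)) :
    IsOrthogonal i f := by
  rw [isOrthogonal_iff_mapHom]
  have := hf.fibration_mapHom i
  refine SSet.IsTrivialFibration.of_comp (mapHom i f) (pullback.fst (Map.pre i Y) (Map.post A f))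
    (isTrivialFibration_of_isPullback (IsPullback.of_hasPullback _ _).flip h) ?_
  have e : mapHom i f ≫ pullback.fst _ _ = Map.post A' f := pullback.lift_fst _ _ _
  rwa [e]

lemma IsReedyFibration.isOrthogonal_of_map_pre {A A' X Y : BiSSet.{u}} {f : X ⟶ Y}
    (hf : IsReedyFibration f) (i : A ⟶ A') [Mono i] (hX : IsOrthogonal i (toUnit X))
    (hY : IsOrthogonal i (toUnit Y)) : IsOrthogonal i f := by
  rw [isOrthogonal_iff_map_pre isTerminalUnit] at hX hY
  rw [isOrthogonal_iff_mapHom]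
  have := hf.fibration_mapHom i
  refine SSet.IsTrivialFibration.of_comp (mapHom i f) (pullback.snd (Map.pre i Y) (Map.post A f))
    (isTrivialFibration_of_isPullback (IsPullback.of_hasPullback _ _) hY) ?_
  have e : mapHom i f ≫ pullback.snd _ _ = Map.pre i X := pullback.lift_snd _ _ _
  rwa [e]

/-- A Reedy fibration which is a trivial fibration at each level is orthogonal to all
monomorphisms. -/
lemma IsReedyFibration.isOrthogonal_boundaryIncl {X Y : BiSSet.{u}} {f : X ⟶ Y}
    (hf : IsReedyFibration f)
    (h : ∀ p : ℕ, SSet.IsTrivialFibration (Map.post (F.obj ⦋p⦌) f)) (p : ℕ) :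
    IsOrthogonal (boundaryIncl p) f := by
  induction p using Nat.strong_induction_on with | _ p IH =>
  -- `∂F(p)` is built from cells of dimension below `p`, its other elements being degenerate, so the
  -- inductive hypothesis makes `Map.post` trivial on it.
  refine hf.isOrthogonal_of_map_post _ (isOrthogonal_initial_iff.1
    (isOrthogonal_of_boundary _ (· < p) IH ?_)) (h p)
  rintro r q ⟨s, hs⟩ hr
  obtain ⟨s, rfl⟩ := SSet.stdSimplex.objEquiv.symm.surjective s
  obtain ⟨r', θ, ι, hr', rfl⟩ := exists_factor_of_not_surjective s hs
  refine Or.inr ⟨r', θ, ⟨SSet.stdSimplex.objEquiv.symm ι, fun h ↦ ?_⟩, ?_, Subtype.ext rfl⟩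
  · have := Fintype.card_le_of_surjective _ h
    simp only [Fintype.card_fin] at this
    have hr'' : r'.len < p := hr'
    have : p + 1 ≤ r'.len + 1 := this
    omega
  · have : r'.len < p := hr'
    omega

lemma IsReedyFibration.isOrthogonal {X Y : BiSSet.{u}} {f : X ⟶ Y} (hf : IsReedyFibration f)
    (h : ∀ p : ℕ, SSet.IsTrivialFibration (Map.post (F.obj ⦋p⦌) f)) {A A' : BiSSet.{u}}
    (i : A ⟶ A') [Mono i] : IsOrthogonal i f :=
  isOrthogonal_of_boundary i (fun _ ↦ True) (fun p _ ↦ hf.isOrthogonal_boundaryIncl h p)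
    (fun _ _ _ h ↦ (h trivial).elim)

/-! ### Exponentials of Segal spaces -/

/-- The pushout-product of `S ⊆ K` with `∂F(n) → F(n)` is again an inclusion of discrete simplicial
spaces. -/
lemma isReedyFibration_expoHom {X : BiSSet.{u}} (hX : IsReedyFibration (toUnit X)) {K : SSet.{u}}
    (S : K.Subcomplex) : IsReedyFibration (expoHom (discrete.map S.ι) (toUnit X)) := by
  rw [isReedyFibration_iff]
  intro n L L' j hj
  rw [← hasLiftingProperty_expoHom_iff, ← hasLiftingProperty_leibniz_assoc,
    hasLiftingProperty_expoHom_iff', hasLiftingProperty_leibniz_iff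
      (discretePushoutObjObj (Subcomplex.unionProd.pushoutObjObj S ∂Δ[n]))]
  refine (hasLiftingProperty_expoHom_iff' _ _ _).1 ?_
  exact hX.hasLiftingProperty (discrete.map (Subcomplex.unionProd S ∂Δ[n]).ι) j hj

lemma isTrivialFibration_map_post_expoHom_iff {A K L X Y : BiSSet.{u}} (i : K ⟶ L) (f : X ⟶ Y) :
    SSet.IsTrivialFibration (Map.post A (expoHom i f)) ↔ IsOrthogonal (A ◁ i) f := by
  have h (m : ℕ) : HasLiftingProperty ∂Δ[m].ι (Map.post A (expoHom i f)) ↔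
      HasLiftingProperty (leibniz (A ◁ i) (constant.map ∂Δ[m].ι)) f := by
    rw [← hasLiftingProperty_map_post_iff, ← hasLiftingProperty_expoHom_iff,
      hasLiftingProperty_leibniz_comm, ← hasLiftingProperty_whiskerLeft_leibniz_iff,
      hasLiftingProperty_expo_post_iff, hasLiftingProperty_leibniz_comm,
      ← hasLiftingProperty_expo_post_iff, hasLiftingProperty_whiskerLeft_leibniz_iff]
  simp only [IsOrthogonal, ← h]
  exact ⟨fun h m ↦ h _ ⟨m⟩, fun h _ _ _ ⟨m⟩ ↦ h m⟩

/-- The case of simplices says that the Reedy fibration `X^{F(n)} → X^{G(n)}` is a trivial fibration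
at each level. It is then orthogonal to `∅ → A`, which is the Segal condition for `X^A`. -/
theorem IsSegalSpace.expo {X : BiSSet.{u}} (hX : IsSegalSpace X) (A : BiSSet.{u}) :
    IsSegalSpace (BiSSet.expo A X) := by
  rw [isSegalSpace_expo_iff hX.reedyFibrant]
  intro n
  rw [← isTrivialFibration_map_post_expoHom_iff, ← isOrthogonal_initial_iff]
  refine (isReedyFibration_expoHom hX.reedyFibrant (spine n)).isOrthogonal (fun p ↦ ?_) _
  rw [isTrivialFibration_map_post_expoHom_iff]
  exact (isSegalSpace_expo_iff hX.reedyFibrant).1 (hX.expo_F p) n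

/-! ### Base change of Segal spaces -/

lemma IsReedyFibration.of_isPullback {W V P U : BiSSet.{u}} {g : P ⟶ W} {q : P ⟶ U} {p : W ⟶ V}
    {b : U ⟶ V} (sq : IsPullback g q p b) (hp : IsReedyFibration p) : IsReedyFibration q := by
  rw [isReedyFibration_iff] at hp ⊢
  intro n K L j hj
  have := hp n j hj
  exact sq.hasLiftingProperty _

lemma IsOrthogonal.of_isPullback {A A' W V P U : BiSSet.{u}} {i : A ⟶ A'} {g : P ⟶ W} {q : P ⟶ U}
    {p : W ⟶ V} {b : U ⟶ V} (sq : IsPullback g q p b) (hp : IsOrthogonal i p) :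
    IsOrthogonal i q := by
  intro m
  have := hp m
  exact sq.hasLiftingProperty _

/-- Segal spaces are stable under base change along Reedy fibrations. -/
lemma IsSegalSpace.of_isPullback {W V P U : BiSSet.{u}} {g : P ⟶ W} {q : P ⟶ U} {p : W ⟶ V}
    {b : U ⟶ V} (sq : IsPullback g q p b) (hp : IsReedyFibration p) (hW : IsSegalSpace W)
    (hV : IsSegalSpace V) (hU : IsSegalSpace U) : IsSegalSpace P := by
  have hq := hp.of_isPullback sq
  rw [isSegalSpace_iff] at hW hV hU ⊢
  rw [← toUnit_unique (q ≫ toUnit U) (toUnit P)]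
  refine ⟨?_, fun n m ↦ ?_⟩
  · rw [isReedyFibration_iff]
    intro n K L j hj
    have := (isReedyFibration_iff _).1 hq n j hj
    have := (isReedyFibration_iff _).1 hU.1 n j hj
    infer_instance
  -- `p` is orthogonal to spine inclusions because both its source and target are Segal; this passes
  -- to the base change `q` and then to `P → U → 1`.
  · have := (hp.isOrthogonal_of_map_pre _ (hW.2 n) (hV.2 n)).of_isPullback sq m
    have := hU.2 n m
    infer_instance

lemma isSegalSpace_point : IsSegalSpace (F.{u}.obj ⦋0⦌) := by
  have h : IsTerminal (F.{u}.obj ⦋0⦌) := SSet.stdSimplex.isTerminalObj₀.{u}.isTerminalObj discrete _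
  have : IsIso (toUnit (F.{u}.obj ⦋0⦌)) :=
    ⟨h.from _, h.hom_ext _ _, isTerminalUnit.hom_ext _ _⟩
  rw [isSegalSpace_iff, isReedyFibration_iff]
  exact ⟨fun n K L j hj ↦ inferInstance, fun n m ↦ inferInstance⟩

lemma isSegalSpace_funOver {B : BiSSet.{u}} (hB : IsSegalSpace B) (A X : Over B)
    (hX : IsSegalSpaceOver X) : IsSegalSpace (FunOver A X) :=
  IsSegalSpace.of_isPullback (IsPullback.of_hasPullback _ _) (hX.isReedyFibration.expo_post A.left)
    (hX.isSegalSpace.expo _) (hB.expo _) isSegalSpace_point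

end

/-! ### The levels of the relative function object -/

/-- Maps `A ⊗ L ⟶ X^G` are maps `(A ⊗ G) ⊗ L ⟶ X`. -/
def expoCurry (A G X L : BiSSet.{u}) : (A ⊗ L ⟶ expo G X) ≃ ((A ⊗ G) ⊗ L ⟶ X) :=
  (expoHomEquiv G (A ⊗ L) X).symm.trans
    ((α_ G A L).symm ≪≫ whiskerRightIso (β_ A G).symm L).homFromEquiv

lemma expoCurry_apply {A G X L : BiSSet.{u}} (g : A ⊗ L ⟶ expo G X) :
    expoCurry A G X L g =
      (β_ A G).hom ▷ L ≫ (α_ G A L).hom ≫ (expoHomEquiv G (A ⊗ L) X).symm g := by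
  simp [expoCurry]

lemma expoHomEquiv_symm_comp {A K K' X : BiSSet.{u}} (h : K' ⟶ K) (g : K ⟶ expo A X) :
    (expoHomEquiv A K' X).symm (h ≫ g) = A ◁ h ≫ (expoHomEquiv A K X).symm g := rfl

lemma expoHomEquiv_symm_comp_post {A K X Y : BiSSet.{u}} (g : K ⟶ expo A X) (f : X ⟶ Y) :
    (expoHomEquiv A K Y).symm (g ≫ expo.post A f) = (expoHomEquiv A K X).symm g ≫ f := rfl

lemma expoCurry_whiskerLeft {A G X L L' : BiSSet.{u}} (t : L' ⟶ L) (g : A ⊗ L ⟶ expo G X) :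
    expoCurry A G X L' (A ◁ t ≫ g) = (A ⊗ G) ◁ t ≫ expoCurry A G X L g := by
  rw [expoCurry_apply, expoCurry_apply, expoHomEquiv_symm_comp, whisker_exchange_assoc]
  simp

lemma expoCurry_whiskerRight {A A' G X L : BiSSet.{u}} (i : A ⟶ A') (g : A' ⊗ L ⟶ expo G X) :
    expoCurry A G X L (i ▷ L ≫ g) = (i ▷ G) ▷ L ≫ expoCurry A' G X L g := by
  rw [expoCurry_apply, expoCurry_apply, expoHomEquiv_symm_comp, ← comp_whiskerRight_assoc,
    BraidedCategory.braiding_naturality_left, comp_whiskerRight_assoc,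
    associator_naturality_middle_assoc]

/-- Mapping spaces into an internal hom. -/
def mapExpoIso (A G X : BiSSet.{u}) : Map A (expo G X) ≅ Map (A ⊗ G) X :=
  NatIso.ofComponents (fun m ↦ (expoCurry A G X (constSimplex.obj m.unop)).toIso)
    (fun φ ↦ by
      ext g
      exact expoCurry_whiskerLeft (constSimplex.map φ.unop) g)

lemma mapExpoIso_pre {A A' : BiSSet.{u}} (i : A ⟶ A') (G X : BiSSet.{u}) :
    Map.pre i (expo G X) ≫ (mapExpoIso A G X).hom =
      (mapExpoIso A' G X).hom ≫ Map.pre (i ▷ G) X := by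
  ext m g
  exact expoCurry_whiskerRight i g

lemma expoCurry_post {A G X Y L : BiSSet.{u}} (g : A ⊗ L ⟶ expo G X) (f : X ⟶ Y) :
    expoCurry A G Y L (g ≫ expo.post G f) = expoCurry A G X L g ≫ f := by
  rw [expoCurry_apply, expoCurry_apply, expoHomEquiv_symm_comp_post]
  simp

lemma mapExpoIso_post (A G : BiSSet.{u}) {X Y : BiSSet.{u}} (f : X ⟶ Y) :
    Map.post A (expo.post G f) ≫ (mapExpoIso A G Y).hom =
      (mapExpoIso A G X).hom ≫ Map.post (A ⊗ G) f := by
  ext m g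
  exact expoCurry_post g f

/-- The diagonal `B ⟶ B^G`. -/
def expoDiag (G B : BiSSet.{u}) : B ⟶ expo G B := expoHomEquiv G B B (snd G B)

/-- Matches base points: under currying, the structure map followed by the diagonal becomes `A × G →
A → B`. -/
lemma vertex_expoDiag {A B : BiSSet.{u}} (G : BiSSet.{u}) (p : A ⟶ B) :
    Map.vertex p ≫ Map.post A (expoDiag G B) ≫ (mapExpoIso A G B).hom =
      Map.vertex (fst A G ≫ p) := by
  ext m x
  change expoCurry A G B _ ((fst A _ ≫ p) ≫ expoDiag G B) = fst _ _ ≫ fst A G ≫ p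
  rw [expoCurry_apply, expoHomEquiv_symm_comp, expoDiag, Equiv.symm_apply_apply]
  simp

/-- The fiberwise internal hom `X^G ×_{B^G} B`. -/
def fiberwiseExpo {B : BiSSet.{u}} (G : BiSSet.{u}) (X : Over B) : Over B :=
  Over.mk (pullback.snd (expo.post G X.hom) (expoDiag G B))

/-- The projection `X^G ×_{B^G} B ⟶ X^G`. -/
def fiberwiseExpoProj {B : BiSSet.{u}} (G : BiSSet.{u}) (X : Over B) :
    (fiberwiseExpo G X).left ⟶ expo G X.left :=
  pullback.fst (expo.post G X.hom) (expoDiag G B)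

lemma isPullback_fiberwiseExpo {B : BiSSet.{u}} (G : BiSSet.{u}) (X : Over B) :
    IsPullback (fiberwiseExpoProj G X) (fiberwiseExpo G X).hom (expo.post G X.hom)
      (expoDiag G B) :=
  IsPullback.of_hasPullback _ _

lemma isSegalSpaceOver_fiberwiseExpo {B : BiSSet.{u}} (hB : IsSegalSpace B) (G : BiSSet.{u})
    {X : Over B} (hX : IsSegalSpaceOver X) : IsSegalSpaceOver (fiberwiseExpo G X) where
  isSegalSpace := IsSegalSpace.of_isPullback (isPullback_fiberwiseExpo G X)
    (hX.isReedyFibration.expo_post G) (hX.isSegalSpace.expo G) (hB.expo G) hB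
  isReedyFibration := (hX.isReedyFibration.expo_post G).of_isPullback
    (isPullback_fiberwiseExpo G X)

/-! ### Relative mapping spaces and function objects as the same fiber -/

section

variable {B : BiSSet.{u}}

/-- The inclusion of the relative mapping space into the mapping space. -/
def MapOver.incl (A X : Over B) : MapOver A X ⟶ Map A.left X.left :=
  pullback.fst (Map.post A.left X.hom) (Map.vertex A.hom)

lemma MapOver.pre_incl {A A' : Over B} (i : A ⟶ A') (X : Over B) :
    MapOver.pre i X ≫ MapOver.incl A X = MapOver.incl A' X ≫ Map.pre i.left X.left :=
  pullback.lift_fst _ _ _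

/-- The projection of the relative mapping space into the fiberwise internal hom. -/
def mapOverProj (G : BiSSet.{u}) (A X : Over B) :
    MapOver A (fiberwiseExpo G X) ⟶ Map (A.left ⊗ G) X.left :=
  MapOver.incl A (fiberwiseExpo G X) ≫ Map.post A.left (fiberwiseExpoProj G X) ≫
    (mapExpoIso A.left G X.left).hom

/-- `Map(A, -)` is a right adjoint, so it preserves the pullback that defines `fiberwiseExpo`;
pasting with the defining square of `MapOver` and with currying exhibits the same fiber as in
`isPullback_funOver`. -/
lemma isPullback_mapOverProj (G : BiSSet.{u}) (A X : Over B) :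
    IsPullback (mapOverProj G A X)
      (pullback.snd (Map.post A.left (fiberwiseExpo G X).hom) (Map.vertex A.hom))
      (Map.post (A.left ⊗ G) X.hom) (Map.vertex (fst A.left G ≫ A.hom)) := by
  have h₁ := IsPullback.of_hasPullback (Map.post A.left (fiberwiseExpo G X).hom)
    (Map.vertex A.hom)
  have : PreservesLimitsOfSize.{0, 0} (mapFunctor.obj (op A.left)) :=
    (tensorConstantMapAdj.adj A.left).rightAdjoint_preservesLimits
  have h₂ : IsPullback (Map.post A.left (fiberwiseExpoProj G X))
      (Map.post A.left (fiberwiseExpo G X).hom) (Map.post A.left (expo.post G X.hom))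
      (Map.post A.left (expoDiag G B)) :=
    (isPullback_fiberwiseExpo G X).map (mapFunctor.obj (op A.left))
  have h₃ : IsPullback (mapExpoIso A.left G X.left).hom (Map.post A.left (expo.post G X.hom))
      (Map.post (A.left ⊗ G) X.hom) (mapExpoIso A.left G B).hom :=
    IsPullback.of_horiz_isIso ⟨(mapExpoIso_post A.left G X.hom).symm⟩
  have h := h₁.paste_horiz (h₂.paste_horiz h₃)
  rw [vertex_expoDiag] at h
  exact h

lemma isPullback_funOver (n : SimplexCategoryᵒᵖ) (A X : Over B) :
    IsPullback ((pullback.fst (expo.post A.left X.hom) (expo.point A.hom)).app n)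
      (SSet.stdSimplex.isTerminalObj₀.from ((FunOver A X).obj n))
      (Map.post (A.left ⊗ F.obj n.unop) X.hom) (Map.vertex (fst A.left _ ≫ A.hom)) := by
  have h := (IsPullback.of_hasPullback (expo.post A.left X.hom) (expo.point A.hom)).map
    ((evaluation _ _).obj n)
  have t : IsTerminal ((F.{u}.obj ⦋0⦌).obj n) :=
    (SSet.stdSimplex.isTerminalObj₀.{u}.isTerminalObj discrete _).isTerminalObj
      ((evaluation _ _).obj n) _
  exact h.of_iso (Iso.refl _) (Iso.refl _) (t.uniqueUpToIso SSet.stdSimplex.isTerminalObj₀)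
    (Iso.refl _) (by simp) (SSet.stdSimplex.isTerminalObj₀.hom_ext _ _) (by simp; rfl)
    (by
      ext m x
      rfl)

/-- The levels of the relative function object are relative mapping spaces. -/
def funOverIso (n : SimplexCategoryᵒᵖ) (A X : Over B) :
    (FunOver A X).obj n ≅ MapOver A (fiberwiseExpo (F.obj n.unop) X) :=
  (isPullback_funOver n A X).isoIsPullback _ _ (isPullback_mapOverProj (F.obj n.unop) A X)

lemma funOverIso_proj (n : SimplexCategoryᵒᵖ) (A X : Over B) :
    (funOverIso n A X).hom ≫ mapOverProj (F.obj n.unop) A X =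
      (pullback.fst (expo.post A.left X.hom) (expo.point A.hom)).app n :=
  (isPullback_funOver n A X).isoIsPullback_hom_fst _ _
    (isPullback_mapOverProj (F.obj n.unop) A X)

lemma mapOverPre_proj (G : BiSSet.{u}) {A A' : Over B} (i : A ⟶ A') (X : Over B) :
    MapOver.pre i (fiberwiseExpo G X) ≫ mapOverProj G A X =
      mapOverProj G A' X ≫ Map.pre (i.left ▷ G) X.left := by
  rw [mapOverProj, reassoc_of% (MapOver.pre_incl i (fiberwiseExpo G X)), mapOverProj,
    Category.assoc, Category.assoc, ← mapExpoIso_pre]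
  rfl

lemma funOverIso_pre (n : SimplexCategoryᵒᵖ) {A A' : Over B} (i : A ⟶ A') (X : Over B) :
    (funOverIso n A' X).hom ≫ MapOver.pre i (fiberwiseExpo (F.obj n.unop) X) =
      (FunOver.pre i X).app n ≫ (funOverIso n A X).hom := by
  have h : FunOver.pre i X ≫ pullback.fst (expo.post A.left X.hom) (expo.point A.hom) =
      pullback.fst (expo.post A'.left X.hom) (expo.point A'.hom) ≫ expo.pre i.left X.left :=
    pullback.lift_fst _ _ _
  refine (isPullback_mapOverProj (F.obj n.unop) A X).hom_ext ?_
    (SSet.stdSimplex.isTerminalObj₀.hom_ext _ _)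
  rw [Category.assoc, mapOverPre_proj, reassoc_of% (funOverIso_proj n A' X), Category.assoc,
    funOverIso_proj]
  exact congr(($h).app n).symm

end

end BiSSet

end

theorem mainTheorem5 (B : BiSSet.{u}) (hB : BiSSet.IsSegalSpace B)
    (A S : Over B) (ι : A ⟶ S) (hι : BiSSet.IsSegalCompletion ι)
    (X : Over B) (hX : BiSSet.IsSegalSpaceOver X) :
    BiSSet.IsSegalSpaceEquiv (BiSSet.FunOver.pre ι X) where
  source := BiSSet.isSegalSpace_funOver hB S X hX
  target := BiSSet.isSegalSpace_funOver hB A X hX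
  -- The completion property is tested on the fiberwise internal hom by `F(n)`, and transported
  -- along the natural identification.
  level n := (hι.isSpaceEquiv _ (BiSSet.isSegalSpaceOver_fiberwiseExpo hB _ hX)).of_iso
    (BiSSet.funOverIso n S X) (BiSSet.funOverIso n A X) (BiSSet.funOverIso_pre n ι X)
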